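/- **Setting.** Let $T>0$, $\nu>0$, $\mathbb T^3=(\mathbb R/2\pi\mathbb Z)^3$; $(\cdot,\cdot)$ and $\|\cdot\|_2$ are the scalar product and norm of $L^2(\mathbb T^3)$ (scalar or vector valued), the subscript $\#$ denotes zero mean value, $\|u\|_{H^1}^2=\|u\|_2^2+\|\nabla u\|_2^2$, $H^{-1}$ is the dual of $H^1$, and $L^2_{\rm div}$ is the space of vector fields in $L^2_\#$ with zero distributional divergence. *Discrete spaces.* Let $\mathcal H\subset(0,\infty)$ be a set of mesh sizes. For $h\in\mathcal H$ let $X_h\subset (H^1_\#)^3$ and $M_h\subset H^1_\#$ be finite dimensional, and let $\pi_h$, $\mathcal K_h$ be the $L^2$-projections onto $X_h$, $M_h$. Assume, with constants $c>0$ independent of $h$: 1. for all $v\in (H^1_\#)^3$ and $q\in L^2_\#$ there are $v_h\in X_h$, $q_h\in M_h$ with $v_h\to v$ in $H^1$ and $q_h\to q$ in $L^2$ as $h\to0$; 2. $\|\pi_h(\nabla q_h)\|_2\ge c\|q_h\|_2$ for all $q_h\in M_h$; 3. $\|v-\pi_h v\|_2\le c\,h\|v\|_{H^1}$ and $\|\pi_h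 v\|_{H^1}\le c\|v\|_{H^1}$ for all $v\in (H^1_\#)^3$; 4. $\|v_h\|_{H^1}\le c\,h^{-1}\|v_h\|_2$ for all $v_h\in X_h$; 5. the map $\psi_h:H^2_\#\to M_h$ defined by $(\pi_h\nabla\psi_h(q),\nabla r_h)=(\nabla q,\nabla r_h)$ for all $r_h\in M_h$ satisfies $\|\nabla(\psi_h(q)-q)\|_2\le c\,h\|q\|_{H^2}$ for all $q\in H^2_\#$. Let $V_h=\{v_h\in X_h:\ (\operatorname{div}v_h,q_h)=0\ \ \forall q_h\in M_h\}$. *Scheme.* Let $b_h(u,v,w)=\langle nl_h(u,v),w\rangle$, where $nl_h(u,v)$ is one of (i) $(u\cdot\nabla)v+\frac12 v\operatorname{div}u$, (ii) $(\nabla\times u)\times v$, (iii) $(\nabla\times u)\times v+\frac12\nabla\mathcal K_h(v\cdot u)$. Let $u_0\in L^2_{\rm div}$, $N\ge1$, $\Delta t=T/N$, $t_m=m\Delta t$. A solution of the Crank–Nicolson scheme is a family $u_h^0,\dots,u_h^N\in X_h$, $p_h^1,\dots,p_h^N\in M_h$ such that $u_h^0$ is the $L^2$-projection of $u_0$ onto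 $V_h$ and, for $m=1,\dots,N$, all $v_h\in X_h$ and all $q_h\in M_h$, with $u_h^{m,1/2}=\frac12(u_h^m+u_h^{m-1})$, $$\Big(\frac{u_h^m-u_h^{m-1}}{\Delta t},v_h\Big)+\nu(\nabla u_h^{m,1/2},\nabla v_h)+b_h(u_h^{m,1/2},u_h^{m,1/2},v_h)-(p_h^m,\operatorname{div}v_h)=0,\qquad (\operatorname{div}u_h^m,q_h)=0 .$$ Let $v_h^{\Delta t}$ be the continuous, piecewise linear interpolant on $[0,T]$ of the values $u_h^m$ at $t_m$, and let $u_h^{\Delta t}$, $p_h^{\Delta t}$ be the step functions equal to $u_h^{m,1/2}$, $p_h^m$ on $[t_{m-1},t_m)$, and to $u_h^{N,1/2}$, $p_h^N$ at $t=T$. *Mesh condition.* A family of parameters $(N,h)$ with $N\ge 1$, $h\in\mathcal H$ satisfies the mesh condition if $$\frac{\Delta t\,\|u_0\|_2^3}{\nu\,h^{1/2}}=o(1)\qquad\text{as }(\Delta t,h)\to(0,0)\text{ within the family.}$$ **Proposition.** For each of the three choices of $nl_h$ there is a constant $c>0$, independent of $\Delta t$ and of $h$, such that for every family of parameters satisfying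 the mesh condition, every $(N,h)$ in it and every solution of the scheme: a) $\|v_h^{\Delta t}\|_{L^\infty(0,T;L^2)}\le c$; b) $\|u_h^{\Delta t}\|_{L^\infty(0,T;L^2)}\le c$ and $\|u_h^{\Delta t}\|_{L^2(0,T;H^1)}\le c$; c) $\|p_h^{\Delta t}\|_{L^{4/3}(0,T;L^2)}\le c$; d) $\|\partial_t v_h^{\Delta t}\|_{L^{4/3}(0,T;H^{-1})}\le c$. Moreover $$\int_0^T\|u_h^{\Delta t}-v_h^{\Delta t}\|_2^2\,dt\le\frac{\Delta t}{12}\sum_{m=1}^N\|u_h^m-u_h^{m-1}\|_2^2 .$$ -/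

import Mathlib

open MeasureTheory Filter Topology
open scoped ENNReal ContDiff Matrix

noncomputable section

namespace CrankNicolsonNSE

/-! ## Function spaces on the flat torus `𝕋³ = (ℝ / 2πℤ)³` -/

instance factTwoPiPos : Fact ((0 : ℝ) < 2 * Real.pi) := ⟨Real.two_pi_pos⟩

/-- The flat torus `(ℝ / 2πℤ)³`, with Lebesgue measure (total mass `(2π)³`). -/
abbrev Torus : Type := Fin 3 → AddCircle (2 * Real.pi)

/-- Scalar `L²(𝕋³)`. -/
abbrev L2 : Type := Lp ℝ 2 (volume : Measure Torus)

/-- Vector valued `L²(𝕋³)³`, with `(u, v) = ∑ i, (uᵢ, vᵢ)`. -/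
abbrev VecL2 : Type := PiLp 2 (fun _ : Fin 3 => L2)

/-- `φ` is `C^∞` on the torus: its periodic lift to `ℝ³` is `C^∞`. -/
def SmoothFn (φ : Torus → ℝ) : Prop :=
  ContDiff ℝ ∞ (fun y : Fin 3 → ℝ => φ (fun i => (y i : AddCircle (2 * Real.pi))))

/-- Classical partial derivative `∂ⱼ φ` on the torus. -/
def partialDeriv (j : Fin 3) (φ : Torus → ℝ) (x : Torus) : ℝ :=
  deriv (fun s : ℝ => φ (x + Pi.single j (s : AddCircle (2 * Real.pi)))) 0

/-- `g ∈ L²` is the weak derivative `∂ⱼ f` of `f ∈ L²`. -/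
def HasWeakDeriv (j : Fin 3) (f g : L2) : Prop :=
  ∀ φ : Torus → ℝ, SmoothFn φ →
    ∫ x, f x * partialDeriv j φ x = - ∫ x, g x * φ x

open Classical in
/-- The weak derivative `∂ⱼ f` (unique when it exists; `0` when there is none in `L²`). -/
def weakDeriv (j : Fin 3) (f : L2) : L2 :=
  if h : ∃ g, HasWeakDeriv j f g then h.choose else 0

/-- `f ∈ H¹(𝕋³)`. -/
def MemH1 (f : L2) : Prop := ∀ j, ∃ g, HasWeakDeriv j f g

/-- `q ∈ H²(𝕋³)`. -/
def MemH2 (q : L2) : Prop := MemH1 q ∧ ∀ i, MemH1 (weakDeriv i q)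

/-- `u ∈ H¹(𝕋³)³`. -/
def MemH1Vec (u : VecL2) : Prop := ∀ i, MemH1 (u i)

/-- Zero mean value. -/
def ZeroMean (f : L2) : Prop := ∫ x, f x = 0

/-- Zero mean value of every component. -/
def ZeroMeanVec (u : VecL2) : Prop := ∀ i, ZeroMean (u i)

/-- `∇ q`. -/
def grad (q : L2) : VecL2 := WithLp.toLp 2 (fun i => weakDeriv i q)

/-- `div u`. -/
def divg (u : VecL2) : L2 := ∑ i, weakDeriv i (u i)

/-- `∇ × u`. -/
def curl (u : VecL2) : VecL2 :=
  WithLp.toLp 2 ![weakDeriv 1 (u 2) - weakDeriv 2 (u 1),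
    weakDeriv 2 (u 0) - weakDeriv 0 (u 2),
    weakDeriv 0 (u 1) - weakDeriv 1 (u 0)]

/-- `(∇ u, ∇ v) = ∑ i j, (∂ⱼ uᵢ, ∂ⱼ vᵢ)`. -/
def gradInner (u v : VecL2) : ℝ := ∑ i, inner ℝ (grad (u i)) (grad (v i))

/-- `‖u‖_{H¹}² = ‖u‖₂² + ‖∇u‖₂²`. -/
def h1Norm (u : VecL2) : ℝ := √(‖u‖ ^ 2 + ∑ i, ‖grad (u i)‖ ^ 2)

/-- `‖q‖_{H²}² = ‖q‖₂² + ‖∇q‖₂² + ‖∇²q‖₂²`. -/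
def h2Norm (q : L2) : ℝ :=
  √(‖q‖ ^ 2 + ‖grad q‖ ^ 2 + ∑ i, ‖grad (weakDeriv i q)‖ ^ 2)

/-- The norm of `f ∈ L²`, acting by `w ↦ (f, w)`, in `H⁻¹ = (H¹)'`. -/
def hNegOneNorm (f : VecL2) : ℝ≥0∞ :=
  ⨆ (w : VecL2) (_ : MemH1Vec w) (_ : h1Norm w ≤ 1), ENNReal.ofReal (inner ℝ f w)

/-- `u ∈ L²_div`: zero mean and divergence free in the sense of distributions. -/
def MemL2Div (u : VecL2) : Prop :=
  ZeroMeanVec u ∧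
    ∀ φ : Torus → ℝ, SmoothFn φ → ∑ i, ∫ x, u i x * partialDeriv i φ x = 0

/-! ## Discrete spaces -/

/-- A pair `(X_h, M_h)` of finite dimensional spaces for the velocity and the pressure, with
`X_h ⊆ H¹_#` and `M_h ⊆ H¹_#`. -/
structure DiscretePair where
  X : Submodule ℝ VecL2
  M : Submodule ℝ L2
  finX : FiniteDimensional ℝ X
  finM : FiniteDimensional ℝ M
  memX : ∀ v ∈ X, MemH1Vec v ∧ ZeroMeanVec v
  memM : ∀ q ∈ M, MemH1 q ∧ ZeroMean q

attribute [instance] DiscretePair.finX DiscretePair.finM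

/-- `π_h`, the `L²` projection onto `X_h`. -/
def DiscretePair.proj (D : DiscretePair) (v : VecL2) : VecL2 := D.X.starProjection v

/-- `𝒦_h`, the `L²` projection onto `M_h`. -/
def DiscretePair.projM (D : DiscretePair) (q : L2) : L2 := D.M.starProjection q

/-- `v ∈ V_h`, the discretely divergence free elements of `X_h`. -/
def DiscretePair.MemV (D : DiscretePair) (v : VecL2) : Prop :=
  v ∈ D.X ∧ ∀ q ∈ D.M, inner ℝ (divg v) q = 0

/-- The standing assumptions on a family `(X_h, M_h)`, `h ∈ H`, of discrete spaces, where `H` is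
the set of mesh sizes; all the constants are independent of `h`. -/
structure Admissible (H : Set ℝ) (D : ℝ → DiscretePair) : Prop where
  pos : ∀ h ∈ H, 0 < h
  /-- approximability of velocities in `H¹` -/
  approxX : ∀ v : VecL2, MemH1Vec v → ZeroMeanVec v →
    ∃ vh : ℝ → VecL2, (∀ h ∈ H, vh h ∈ (D h).X) ∧
      Tendsto (fun h => h1Norm (vh h - v)) (𝓝[H] 0) (𝓝 0)
  /-- approximability of pressures in `L²` -/
  approxM : ∀ q : L2, ZeroMean q →
    ∃ qh : ℝ → L2, (∀ h ∈ H, qh h ∈ (D h).M) ∧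
      Tendsto (fun h => ‖qh h - q‖) (𝓝[H] 0) (𝓝 0)
  /-- coercivity -/
  coercive : ∃ c : ℝ, 0 < c ∧ ∀ h ∈ H, ∀ q ∈ (D h).M, c * ‖q‖ ≤ ‖(D h).proj (grad q)‖
  /-- approximation rate of `π_h` -/
  projApprox : ∃ c : ℝ, ∀ h ∈ H, ∀ v : VecL2, MemH1Vec v → ZeroMeanVec v →
    ‖v - (D h).proj v‖ ≤ c * h * h1Norm v
  /-- `H¹` stability of `π_h` -/
  projStable : ∃ c : ℝ, ∀ h ∈ H, ∀ v : VecL2, MemH1Vec v → ZeroMeanVec v →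
    h1Norm ((D h).proj v) ≤ c * h1Norm v
  /-- inverse inequality -/
  inverse : ∃ c : ℝ, ∀ h ∈ H, ∀ v ∈ (D h).X, h1Norm v ≤ c * h⁻¹ * ‖v‖
  /-- approximation rate of the discrete Poisson map `ψ_h : H²_# → M_h`, where `ψ_h(q)` is the
  solution `ψ ∈ M_h` (unique, by coercivity) of `(π_h ∇ψ, ∇r) = (∇q, ∇r)` for all `r ∈ M_h` -/
  poissonApprox : ∃ c : ℝ, ∀ h ∈ H, ∀ q : L2, MemH2 q → ZeroMean q →
    ∀ ψ ∈ (D h).M,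
      (∀ r ∈ (D h).M, inner ℝ ((D h).proj (grad ψ)) (grad r) = inner ℝ (grad q) (grad r)) →
      ‖grad (ψ - q)‖ ≤ c * h * h2Norm q

/-! ## The convective term -/

/-- The three discretizations of the convective term. -/
inductive Convection
  /-- `nl_h(u,v) = (u·∇)v + ½ v div u` -/
  | symmetrized
  /-- `nl_h(u,v) = (∇×u)×v` -/
  | rotational
  /-- `nl_h(u,v) = (∇×u)×v + ½ ∇ 𝒦_h(v·u)` -/
  | rotationalBernoulli

open Classical in
/-- The element of `L²` given by a square integrable function. -/
def toL2 (f : Torus → ℝ) : L2 :=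
  if h : MemLp f 2 (volume : Measure Torus) then h.toLp f else 0

/-- `((∇×u)×v, w)` -/
def rotForm (u v w : VecL2) : ℝ :=
  ∫ x, ((fun i => curl u i x) ⨯₃ (fun i => v i x)) ⬝ᵥ (fun i => w i x)

/-- The trilinear form `b_h(u,v,w) = ⟨nl_h(u,v), w⟩`. -/
def trilinear (D : DiscretePair) : Convection → VecL2 → VecL2 → VecL2 → ℝ
  | .symmetrized, u, v, w =>
      ∫ x, ((∑ i, ∑ j, u j x * weakDeriv j (v i) x * w i x)
        + (1 / 2) * ∑ i, v i x * divg u x * w i x)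
  | .rotational, u, v, w => rotForm u v w
  | .rotationalBernoulli, u, v, w =>
      rotForm u v w
        + (1 / 2) * inner ℝ (grad (D.projM (toL2 (fun x => ∑ i, v i x * u i x)))) w

/-! ## The Crank–Nicolson scheme and the interpolants -/

/-- `u^{m,1/2} = ½ (u^m + u^{m-1})` -/
def half (u : ℕ → VecL2) (m : ℕ) : VecL2 := (1 / 2 : ℝ) • (u m + u (m - 1))

/-- `(u^m)_{0 ≤ m ≤ N}`, `(p^m)_{1 ≤ m ≤ N}` solve the Crank–Nicolson scheme with time step `dt`. -/
structure IsCNSolution (D : DiscretePair) (κ : Convection) (ν dt : ℝ) (N : ℕ) (u₀ : VecL2)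
    (u : ℕ → VecL2) (p : ℕ → L2) : Prop where
  /-- the initial value `u^0` is the `L²` projection of `u₀` onto `V_h` -/
  init_mem : D.MemV (u 0)
  init_proj : ∀ w, D.MemV w → inner ℝ (u 0) w = inner ℝ u₀ w
  memX : ∀ m, 1 ≤ m → m ≤ N → u m ∈ D.X
  memM : ∀ m, 1 ≤ m → m ≤ N → p m ∈ D.M
  momentum : ∀ m, 1 ≤ m → m ≤ N → ∀ v ∈ D.X,
    inner ℝ (dt⁻¹ • (u m - u (m - 1))) v + ν * gradInner (half u m) v
      + trilinear D κ (half u m) (half u m) v - inner ℝ (p m) (divg v) = 0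
  incompressible : ∀ m, 1 ≤ m → m ≤ N → ∀ q ∈ D.M, inner ℝ (divg (u m)) q = 0

/-- The index `m` with `t ∈ [t_{m-1}, t_m)`, `t_m = m dt`, for `t ≥ 0`. -/
def stepIndex (dt t : ℝ) : ℕ := ⌊t / dt⌋₊ + 1

/-- The piecewise linear interpolant `v` of the `u^m` on `[0, N dt]`. -/
def vInterp (dt : ℝ) (N : ℕ) (u : ℕ → VecL2) (t : ℝ) : VecL2 :=
  if t < N * dt then
    u (stepIndex dt t - 1) + ((t - ((stepIndex dt t - 1 : ℕ) : ℝ) * dt) / dt) •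
      (u (stepIndex dt t) - u (stepIndex dt t - 1))
  else u N

/-- The step function `u`, equal to `u^{m,1/2}` on `[t_{m-1}, t_m)`. -/
def uInterp (dt : ℝ) (N : ℕ) (u : ℕ → VecL2) (t : ℝ) : VecL2 :=
  if t < N * dt then half u (stepIndex dt t) else half u N

/-- The step function `p`, equal to `p^m` on `[t_{m-1}, t_m)`. -/
def pInterp (dt : ℝ) (N : ℕ) (p : ℕ → L2) (t : ℝ) : L2 :=
  if t < N * dt then p (stepIndex dt t) else p N

/-- Lebesgue measure on the time interval `[0,T]`. -/
def timeMeasure (T : ℝ) : Measure ℝ := volume.restrict (Set.Icc 0 T)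

/-- The mesh condition `Δt ‖u₀‖₂³ / (ν h^{1/2}) = o(1)` as `(Δt, h) → (0,0)` within the family `P`
of discretization parameters `(N, h)`, where `Δt = T / N`. -/
def MeshCondition (T ν : ℝ) (u₀ : VecL2) (P : Set (ℕ × ℝ)) : Prop :=
  Tendsto (fun d : ℕ × ℝ => (T / d.1) * ‖u₀‖ ^ 3 / (ν * d.2 ^ (1 / 2 : ℝ)))
    (comap (fun d : ℕ × ℝ => (T / (d.1 : ℝ), d.2)) (𝓝 (0, 0)) ⊓ 𝓟 P) (𝓝 0)

end CrankNicolsonNSE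

end

noncomputable section

namespace CrankNicolsonNSE


/-! Everything rests on an exact discrete energy law. Testing the momentum equation with the
midpoint value `half u m`, which lies in V_h, kills the pressure and the convective term: case (i)
is skew-symmetric after integration by parts, in cases (ii) and (iii) the vector (∇×u)×u is
orthogonal to u, and the Bernoulli gradient in (iii) has a potential in M_h, hence pairs to zero
with a discretely divergence free field (`trilinear_self`). Summing in time bounds every ‖u^m‖₂ by
‖u₀‖₂ and Δt ∑ ‖u^{m,1/2}‖²_{H¹} by the data, which gives a) and b).

For c) and d) the convective form is estimated by Hölder in L³ · L⁶ · L², interpolation of L³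
between L² and L⁶, and the embedding H¹ ⊆ L⁶. The result is a bound by a multiple of ‖u‖₂^{1/2}
‖u‖_{H¹}^{3/2} ‖w‖_{H¹} (`abs_trilinear_le`). The power 3/2 is what fixes the time exponent:
(3/2)(4/3) = 2, so the energy bound is exactly what L^{4/3} in time requires.

The pressure is isolated by a special test function (`Admissible.exists_inf_sup`): with -Δq = p and
ψ = ψ_h(q), the field v = π_h ∇ψ satisfies (p, div v) = -‖p‖², is bounded in H¹ by ‖p‖, and is
orthogonal to V_h, so that the discrete time derivative disappears. Once p is bounded, testing with
π_h w bounds the time derivative in H⁻¹, by the H¹ stability of π_h. The last inequality is in fact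
an equality, computed cell by cell.

The analysis on the torus is built from Fourier series, which provide uniqueness of weak
derivatives, density of smooth functions in H¹ and H² regularity for the Poisson problem. The
Sobolev embedding comes from the Gagliardo–Nirenberg argument along coordinate circles. -/

/-! ## Smooth functions on the torus -/

/-- The covering map `ℝ³ → 𝕋³`. -/
def torusMk (y : Fin 3 → ℝ) : Torus := fun i => (y i : AddCircle (2 * Real.pi))

theorem isOpenQuotientMap_torusMk : IsOpenQuotientMap torusMk :=
  IsOpenQuotientMap.piMap (fun _ => QuotientAddGroup.isOpenQuotientMap_mk)

theorem torusMk_add_single (y : Fin 3 → ℝ) (j : Fin 3) (s : ℝ) :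
    torusMk y + Pi.single j (s : AddCircle (2 * Real.pi)) = torusMk (y + s • Pi.single j 1) := by
  ext i
  by_cases h : i = j
  · subst h; simp [torusMk]
  · simp [torusMk, h]

theorem smoothFn_iff {φ : Torus → ℝ} : SmoothFn φ ↔ ContDiff ℝ ∞ (φ ∘ torusMk) := Iff.rfl

theorem SmoothFn.continuous {φ : Torus → ℝ} (h : SmoothFn φ) : Continuous φ :=
  isOpenQuotientMap_torusMk.isQuotientMap.continuous_iff.2 (smoothFn_iff.1 h).continuous

theorem SmoothFn.mul {φ ψ : Torus → ℝ} (hφ : SmoothFn φ) (hψ : SmoothFn ψ) :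
    SmoothFn (fun x => φ x * ψ x) := ContDiff.mul hφ hψ

theorem SmoothFn.pow {φ : Torus → ℝ} (hφ : SmoothFn φ) (k : ℕ) :
    SmoothFn (fun x => φ x ^ k) := ContDiff.pow hφ k

theorem smoothFn_const (c : ℝ) : SmoothFn (fun _ => c) := contDiff_const

theorem SmoothFn.sum {ι : Type*} {φ : ι → Torus → ℝ} (s : Finset ι)
    (h : ∀ i ∈ s, SmoothFn (φ i)) : SmoothFn (fun x => ∑ i ∈ s, φ i x) :=
  ContDiff.sum (f := fun i y => φ i (torusMk y)) h

/-- `partialDeriv` differentiates at parameter 0 only; moving the base point along the circle gives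
the derivative at every parameter. -/
theorem SmoothFn.hasDerivAt {φ : Torus → ℝ} (h : SmoothFn φ) (j : Fin 3) (x : Torus) (s : ℝ) :
    HasDerivAt (fun s : ℝ => φ (x + Pi.single j (s : AddCircle (2 * Real.pi))))
      (partialDeriv j φ (x + Pi.single j (s : AddCircle (2 * Real.pi)))) s := by
  obtain ⟨y, rfl⟩ := isOpenQuotientMap_torusMk.surjective x
  have key : ∀ y : Fin 3 → ℝ, DifferentiableAt ℝ
      (fun s : ℝ => φ (torusMk y + Pi.single j (s : AddCircle (2 * Real.pi)))) 0 := by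
    intro y
    simp_rw [torusMk_add_single]
    exact (((smoothFn_iff.1 h).differentiable (by simp)).comp
      (by fun_prop : Differentiable ℝ (fun s : ℝ => y + s • (Pi.single j 1 : Fin 3 → ℝ)))) 0
  have h1 : HasDerivAt (fun r : ℝ => φ (torusMk y + Pi.single j (s : AddCircle (2 * Real.pi))
      + Pi.single j (r : AddCircle (2 * Real.pi))))
      (partialDeriv j φ (torusMk y + Pi.single j (s : AddCircle (2 * Real.pi)))) (s - s) := by
    rw [torusMk_add_single, sub_self]
    exact (key (y + s • Pi.single j 1)).hasDerivAt
  have h2 := HasDerivAt.scomp (h := fun r : ℝ => r - s) (h' := 1) s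
    h1 ((hasDerivAt_id s).sub_const s)
  simp only [one_smul] at h2
  refine h2.congr_of_eventuallyEq (Eventually.of_forall fun r => ?_)
  simp only [Function.comp]
  congr 1
  rw [add_assoc, ← Pi.single_add, ← AddCircle.coe_add, add_sub_cancel]

theorem SmoothFn.hasDerivAt_zero {φ : Torus → ℝ} (h : SmoothFn φ) (j : Fin 3) (x : Torus) :
    HasDerivAt (fun s : ℝ => φ (x + Pi.single j (s : AddCircle (2 * Real.pi))))
      (partialDeriv j φ x) 0 := by
  simpa using h.hasDerivAt j x 0

theorem SmoothFn.partialDeriv {φ : Torus → ℝ} (h : SmoothFn φ) (j : Fin 3) :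
    SmoothFn (partialDeriv j φ) := by
  have h' := smoothFn_iff.1 h
  have e : CrankNicolsonNSE.partialDeriv j φ ∘ torusMk
      = fun y => fderiv ℝ (φ ∘ torusMk) y (Pi.single j 1) := by
    funext y
    have h1 := h.hasDerivAt_zero j (torusMk y)
    simp_rw [torusMk_add_single] at h1
    have h2 : HasDerivAt (fun s : ℝ => y + s • (Pi.single j 1 : Fin 3 → ℝ)) (Pi.single j 1) 0 := by
      simpa using ((hasDerivAt_id (0 : ℝ)).smul_const (Pi.single j 1 : Fin 3 → ℝ)).const_add y
    have h3 : HasFDerivAt (φ ∘ torusMk) (fderiv ℝ (φ ∘ torusMk) y)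
        (y + (0 : ℝ) • (Pi.single j 1 : Fin 3 → ℝ)) := by
      simpa using (h'.differentiable (by simp) y).hasFDerivAt
    exact h1.unique (HasFDerivAt.comp_hasDerivAt (l := φ ∘ torusMk) 0 h3 h2)
  rw [smoothFn_iff, e]
  exact (h'.fderiv_right (m := ∞) (by simp)).clm_apply contDiff_const

theorem partialDeriv_eq_of_hasDerivAt {φ : Torus → ℝ} {j : Fin 3} {x : Torus} {c : ℝ}
    (h : HasDerivAt (fun s : ℝ => φ (x + Pi.single j (s : AddCircle (2 * Real.pi)))) c 0) :
    partialDeriv j φ x = c := h.deriv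

theorem SmoothFn.partialDeriv_mul {φ ψ : Torus → ℝ} (hφ : SmoothFn φ) (hψ : SmoothFn ψ)
    (j : Fin 3) (x : Torus) : CrankNicolsonNSE.partialDeriv j (fun x => φ x * ψ x) x
      = CrankNicolsonNSE.partialDeriv j φ x * ψ x + φ x * CrankNicolsonNSE.partialDeriv j ψ x := by
  apply partialDeriv_eq_of_hasDerivAt
  have h := (hφ.hasDerivAt_zero j x).fun_mul (hψ.hasDerivAt_zero j x)
  simpa only [AddCircle.coe_zero, Pi.single_zero, add_zero] using h

theorem SmoothFn.partialDeriv_pow {φ : Torus → ℝ} (hφ : SmoothFn φ) (k : ℕ)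
    (j : Fin 3) (x : Torus) : CrankNicolsonNSE.partialDeriv j (fun x => φ x ^ k) x
      = k * φ x ^ (k - 1) * CrankNicolsonNSE.partialDeriv j φ x := by
  apply partialDeriv_eq_of_hasDerivAt
  have h := (hφ.hasDerivAt_zero j x).fun_pow k
  simpa only [AddCircle.coe_zero, Pi.single_zero, add_zero] using h

theorem SmoothFn.integrable {φ : Torus → ℝ} (h : SmoothFn φ) : Integrable φ :=
  h.continuous.integrable_of_hasCompactSupport (HasCompactSupport.of_compactSpace _)

theorem integral_comp_add_torus (ψ : Torus → ℝ) (t : Torus) :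
    ∫ x, ψ (x + t) = ∫ x, ψ x :=
  integral_add_right_eq_self ψ t

/-- By translation invariance s ↦ ∫ φ(x + s e_j) dx is constant; differentiating under the integral
at s = 0 gives the claim. -/
theorem SmoothFn.integral_partialDeriv {φ : Torus → ℝ} (h : SmoothFn φ) (j : Fin 3) :
    ∫ x, CrankNicolsonNSE.partialDeriv j φ x = 0 := by
  obtain ⟨C, hC⟩ := isCompact_univ.exists_bound_of_continuousOn
    (h.partialDeriv j).continuous.continuousOn
  let τ : ℝ → Torus := fun s => Pi.single j (s : AddCircle (2 * Real.pi))
  have hτ : τ 0 = 0 := by simp [τ]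
  have hd : ∀ (x : Torus) (s : ℝ), HasDerivAt (fun s => φ (x + τ s))
    (CrankNicolsonNSE.partialDeriv j φ (x + τ s)) s := h.hasDerivAt j
  have hc : ∀ {ψ : Torus → ℝ}, Continuous ψ → ∀ s : ℝ, AEStronglyMeasurable
      (fun x : Torus => ψ (x + τ s)) volume := fun hψ s =>
    (hψ.comp (continuous_id.add continuous_const)).aestronglyMeasurable
  have h0 : Integrable (fun x : Torus => φ (x + τ 0)) volume := by
    simpa only [hτ, add_zero] using h.integrable
  clear_value τ
  have hm := fun s => hc h.continuous s
  have hm' := hc (h.partialDeriv j).continuous 0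
  generalize CrankNicolsonNSE.partialDeriv j φ = φ' at *
  have h1 : HasDerivAt (fun s => ∫ x, φ (x + τ s)) (∫ x, φ' (x + τ 0)) 0 :=
    (hasDerivAt_integral_of_dominated_loc_of_deriv_le (bound := fun _ => C) (s := Set.univ)
      univ_mem (Eventually.of_forall hm) h0 hm'
      (Eventually.of_forall fun x s _ => hC _ (Set.mem_univ _))
      (integrable_const _)
      (Eventually.of_forall fun x s _ => hd x s)).2
  simp only [integral_comp_add_torus] at h1
  exact h1.unique (hasDerivAt_const _ _)

theorem SmoothFn.integral_mul_partialDeriv {φ ψ : Torus → ℝ} (hφ : SmoothFn φ) (hψ : SmoothFn ψ)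
    (j : Fin 3) : ∫ x, φ x * CrankNicolsonNSE.partialDeriv j ψ x
      = - ∫ x, CrankNicolsonNSE.partialDeriv j φ x * ψ x := by
  have h := (hφ.mul hψ).integral_partialDeriv j
  simp_rw [hφ.partialDeriv_mul hψ] at h
  rw [integral_add ((hφ.partialDeriv j).mul hψ).integrable
    (hφ.mul (hψ.partialDeriv j)).integrable] at h
  linarith

/-! ### The L² pairing and weak derivatives -/

theorem SmoothFn.memLp {φ : Torus → ℝ} (h : SmoothFn φ) (p : ℝ≥0∞) :
    MemLp φ p (volume : Measure Torus) := by
  obtain ⟨C, hC⟩ := isCompact_univ.exists_bound_of_continuousOn h.continuous.continuousOn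
  exact MemLp.of_bound h.continuous.aestronglyMeasurable C
    (Eventually.of_forall fun x => hC x (Set.mem_univ _))

theorem toL2_coe {f : Torus → ℝ} (h : MemLp f 2 (volume : Measure Torus)) :
    (toL2 f : Torus → ℝ) =ᵐ[volume] f := by
  rw [toL2, dif_pos h]; exact h.coeFn_toLp

theorem inner_toL2 {ψ : Torus → ℝ} (h : MemLp ψ 2 (volume : Measure Torus)) (f : L2) :
    inner ℝ (toL2 ψ) f = ∫ x, f x * ψ x := by
  rw [L2.inner_def]
  apply integral_congr_ae
  filter_upwards [toL2_coe h] with x hx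
  simp [hx]

/-- As an identity of inner products, the relation is visibly linear and closed under L² limits. -/
theorem hasWeakDeriv_iff {j : Fin 3} {f g : L2} : HasWeakDeriv j f g ↔
    ∀ φ : Torus → ℝ, SmoothFn φ →
      inner ℝ (toL2 (partialDeriv j φ)) f = - inner ℝ (toL2 φ) g := by
  refine forall₂_congr fun φ hφ => ?_
  rw [inner_toL2 ((hφ.partialDeriv j).memLp 2), inner_toL2 (hφ.memLp 2)]

theorem SmoothFn.hasWeakDeriv {φ : Torus → ℝ} (h : SmoothFn φ) (j : Fin 3) :
    HasWeakDeriv j (toL2 φ) (toL2 (CrankNicolsonNSE.partialDeriv j φ)) := by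
  intro ψ hψ
  have := h.integral_mul_partialDeriv hψ j
  rw [integral_congr_ae (g := fun x => φ x * CrankNicolsonNSE.partialDeriv j ψ x), this,
    integral_congr_ae]
  · filter_upwards [toL2_coe ((h.partialDeriv j).memLp 2)] with x hx
    rw [hx]
  · filter_upwards [toL2_coe (h.memLp 2)] with x hx
    rw [hx]

theorem HasWeakDeriv.add {j : Fin 3} {f g f' g' : L2} (h : HasWeakDeriv j f g)
    (h' : HasWeakDeriv j f' g') : HasWeakDeriv j (f + f') (g + g') := by
  rw [hasWeakDeriv_iff] at *
  intro φ hφ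
  rw [inner_add_right, inner_add_right, h φ hφ, h' φ hφ]; ring

theorem HasWeakDeriv.smul {j : Fin 3} {f g : L2} (c : ℝ) (h : HasWeakDeriv j f g) :
    HasWeakDeriv j (c • f) (c • g) := by
  rw [hasWeakDeriv_iff] at *
  intro φ hφ
  rw [inner_smul_right, inner_smul_right, h φ hφ]; ring

theorem hasWeakDeriv_of_tendsto {ι : Type*} {l : Filter ι} [l.NeBot] {j : Fin 3} {f g : L2}
    {F G : ι → L2} (hF : Tendsto F l (𝓝 f)) (hG : Tendsto G l (𝓝 g))
    (h : ∀ i, HasWeakDeriv j (F i) (G i)) : HasWeakDeriv j f g := by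
  rw [hasWeakDeriv_iff]
  intro φ hφ
  have h1 : Tendsto (fun i => inner ℝ (toL2 (partialDeriv j φ)) (F i)) l
      (𝓝 (inner ℝ (toL2 (partialDeriv j φ)) f)) := tendsto_const_nhds.inner hF
  have h2 : Tendsto (fun i => - inner ℝ (toL2 φ) (G i)) l
      (𝓝 (- inner ℝ (toL2 φ) g)) := (tendsto_const_nhds.inner hG).neg
  simp_rw [← hasWeakDeriv_iff.1 (h _) φ hφ] at h2
  exact tendsto_nhds_unique h1 h2


/-! ## Fourier series on the torus -/

open Algebra Submodule in
section

/-- The exponential monomial `x ↦ e^{i n·x}`. -/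
def monomial (n : Fin 3 → ℤ) : C(Torus, ℂ) where
  toFun x := ∏ i, fourier (n i) (x i)
  continuous_toFun := by fun_prop

theorem monomial_apply (n : Fin 3 → ℤ) (x : Torus) :
    monomial n x = ∏ i, fourier (n i) (x i) := rfl

theorem monomial_neg (n : Fin 3 → ℤ) (x : Torus) :
    monomial (-n) x = starRingEnd ℂ (monomial n x) := by
  simp only [monomial_apply, Pi.neg_apply, fourier_neg, map_prod]

theorem monomial_add (m n : Fin 3 → ℤ) (x : Torus) :
    monomial (m + n) x = monomial m x * monomial n x := by
  simp only [monomial_apply, Pi.add_apply, fourier_add, ← Finset.prod_mul_distrib]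

theorem monomial_zero : monomial 0 = 1 := by
  ext x
  simp [monomial_apply]

theorem monomial_single (x : Torus) (i : Fin 3) :
    monomial (Pi.single i 1) x = fourier 1 (x i) := by
  rw [monomial_apply, Finset.prod_eq_single i]
  · rw [Pi.single_eq_same]
  · intro j _ hj
    rw [Pi.single_eq_of_ne hj, fourier_zero]
  · simp

/-- The star subalgebra of `C(𝕋³, ℂ)` generated by the monomials. -/
def monomialSubalgebra : StarSubalgebra ℂ C(Torus, ℂ) where
  toSubalgebra := Algebra.adjoin ℂ (Set.range monomial)
  star_mem' := by
    change Algebra.adjoin ℂ (Set.range monomial) ≤ star (Algebra.adjoin ℂ (Set.range monomial))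
    refine adjoin_le ?_
    rintro _ ⟨n, rfl⟩
    refine subset_adjoin ⟨-n, ?_⟩
    ext1 x
    simp only [monomial_neg, starRingEnd_apply, ContinuousMap.star_apply]

theorem monomialSubalgebra_coe :
    monomialSubalgebra.toSubalgebra.toSubmodule = span ℂ (Set.range monomial) := by
  apply adjoin_eq_span_of_subset
  refine .trans (fun x ↦ Submonoid.closure_induction (fun _ ↦ id) ⟨0, monomial_zero⟩ ?_) subset_span
  rintro _ _ _ _ ⟨m, rfl⟩ ⟨n, rfl⟩
  exact ⟨m + n, by ext z; simp [monomial_add]⟩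

/-- Points that differ in the i-th coordinate are separated by e^{i x_i}, which is injective on a
circle of length 2π. This is the input to Stone–Weierstrass. -/
theorem monomialSubalgebra_separatesPoints : monomialSubalgebra.SeparatesPoints := by
  intro x y hxy
  rw [Ne, funext_iff, not_forall] at hxy
  obtain ⟨i, hi⟩ := hxy
  refine ⟨_, ⟨monomial (Pi.single i 1), subset_adjoin ⟨Pi.single i 1, rfl⟩, rfl⟩, ?_⟩
  dsimp only
  rw [monomial_single, monomial_single, fourier_one, fourier_one]
  exact fun h => hi (AddCircle.injective_toCircle Real.two_pi_pos.ne' (Circle.ext h))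

theorem span_monomial_closure_eq_top :
    (span ℂ (Set.range monomial)).topologicalClosure = ⊤ := by
  rw [← monomialSubalgebra_coe]
  exact congr_arg (Subalgebra.toSubmodule <| StarSubalgebra.toSubalgebra ·)
    (ContinuousMap.starSubalgebra_topologicalClosure_eq_top_of_separatesPoints _
      monomialSubalgebra_separatesPoints)

end

/-- Complex valued `L²(𝕋³)`. -/
abbrev CL2 : Type := Lp ℂ 2 (volume : Measure Torus)

/-- The normalization `(2π)^{-3/2}` of the monomials in `L²`. -/
def monomialScale : ℝ := (√((2 * Real.pi) ^ 3))⁻¹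

theorem monomialScale_pos : 0 < monomialScale := by
  have := Real.pi_pos
  unfold monomialScale; positivity

theorem monomialScale_sq : monomialScale * monomialScale * (2 * Real.pi) ^ 3 = 1 := by
  have := Real.pi_pos
  have h : √((2 * Real.pi) ^ 3) * √((2 * Real.pi) ^ 3) = (2 * Real.pi) ^ 3 :=
    Real.mul_self_sqrt (by positivity)
  unfold monomialScale
  rw [← mul_inv, h, inv_mul_cancel₀ (by positivity)]

/-- The normalized monomials in `L²`. -/
def monomialL2 (n : Fin 3 → ℤ) : CL2 :=
  (monomialScale : ℂ) • ContinuousMap.toLp (E := ℂ) 2 volume ℂ (monomial n)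

theorem integral_fourier (n : ℤ) :
    ∫ x : AddCircle (2 * Real.pi), fourier n x = if n = 0 then (2 * Real.pi : ℂ) else 0 := by
  rw [AddCircle.volume_eq_smul_haarAddCircle, integral_smul_measure]
  have := fourierCoeff_fourier (T := 2 * Real.pi) (n := n)
  have h0 := congrFun this 0
  rw [fourierCoeff] at h0
  simp only [neg_zero, fourier_zero, one_smul] at h0
  rw [h0]
  by_cases h : n = 0
  · subst h; simp [Real.pi_pos.le]
  · simp [h, Ne.symm h]

theorem integral_monomial (n : Fin 3 → ℤ) :
    ∫ x, monomial n x = if n = 0 then ((2 * Real.pi) ^ 3 : ℂ) else 0 := by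
  simp_rw [monomial_apply]
  rw [integral_fintype_prod_volume_eq_prod
    (fun (i : Fin 3) (x : AddCircle (2 * Real.pi)) => (fourier (n i) x : ℂ))]
  simp_rw [integral_fourier]
  split_ifs with h
  · subst h; simp
  · obtain ⟨i, hi⟩ := Function.ne_iff.mp h
    exact Finset.prod_eq_zero (Finset.mem_univ i) (by simpa using hi)

theorem orthonormal_monomialL2 : Orthonormal ℂ monomialL2 := by
  rw [orthonormal_iff_ite]
  intro m n
  rw [monomialL2, monomialL2, inner_smul_left, inner_smul_right, ContinuousMap.inner_toLp]
  simp only [← monomial_neg, ← monomial_add, integral_monomial, Complex.conj_ofReal]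
  have h : n + -m = 0 ↔ m = n := by rw [← sub_eq_add_neg, sub_eq_zero, eq_comm]
  simp only [h]
  split_ifs
  · rw [← mul_assoc]; exact_mod_cast monomialScale_sq
  · simp

theorem span_monomialL2_closure_eq_top :
    (Submodule.span ℂ (Set.range monomialL2)).topologicalClosure = ⊤ := by
  have h1 : (Submodule.span ℂ (Set.range
      fun n => ContinuousMap.toLp (E := ℂ) 2 (volume : Measure Torus) ℂ (monomial n))).topologicalClosure
      = ⊤ := by
    simpa only [Submodule.map_span, ContinuousLinearMap.coe_coe, ← Set.range_comp,
      Function.comp_def] using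
      (ContinuousMap.toLp_denseRange ℂ (volume : Measure Torus) ℂ
        (p := 2) (by simp)).topologicalClosure_map_submodule span_monomial_closure_eq_top
  rw [← top_le_iff, ← h1]
  refine Submodule.topologicalClosure_mono (Submodule.span_le.2 ?_)
  rintro _ ⟨n, rfl⟩
  have h2 : monomialL2 n ∈ Submodule.span ℂ (Set.range monomialL2) :=
    Submodule.subset_span ⟨n, rfl⟩
  have h3 := Submodule.smul_mem _ ((monomialScale : ℂ)⁻¹) h2
  rwa [monomialL2, smul_smul, inv_mul_cancel₀ (by exact_mod_cast monomialScale_pos.ne'),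
    one_smul] at h3

/-- The Fourier basis of `L²(𝕋³)`. -/
def torusBasis : HilbertBasis (Fin 3 → ℤ) ℂ CL2 :=
  HilbertBasis.mk orthonormal_monomialL2 span_monomialL2_closure_eq_top.ge

theorem torusBasis_apply (n : Fin 3 → ℤ) : torusBasis n = monomialL2 n := by
  rw [torusBasis, HilbertBasis.coe_mk]

/-- Square summable families of Fourier coefficients. -/
abbrev FourierSeq : Type := lp (fun _ : Fin 3 → ℤ => ℂ) 2

/-- The real part of the function with given Fourier coefficients. -/
def synth : FourierSeq →L[ℝ] L2 :=
  (Complex.reCLM.compLpL 2 (volume : Measure Torus)).comp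
    ((torusBasis.repr.symm.toContinuousLinearEquiv : FourierSeq →L[ℂ] CL2).restrictScalars ℝ)

/-- The Fourier coefficients of a real function. -/
def coeffs : L2 →L[ℝ] FourierSeq :=
  ((torusBasis.repr.toContinuousLinearEquiv : CL2 →L[ℂ] FourierSeq).restrictScalars ℝ).comp
    (Complex.ofRealCLM.compLpL 2 (volume : Measure Torus))

/-- The real part undoes the inclusion of real functions into complex ones. Only this composition is
the identity: `coeffs (synth a)` is the Hermitian part of `a`. -/
theorem synth_coeffs (f : L2) : synth (coeffs f) = f := by
  have h : synth (coeffs f) = Complex.reCLM.compLpL 2 (volume : Measure Torus)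
      (Complex.ofRealCLM.compLpL 2 (volume : Measure Torus) f) := by
    simp [synth, coeffs]
  rw [h]
  apply Lp.ext
  filter_upwards [Complex.reCLM.coeFn_compLpL (p := 2) (μ := (volume : Measure Torus))
    (Complex.ofRealCLM.compLpL 2 (volume : Measure Torus) f),
    Complex.ofRealCLM.coeFn_compLpL (p := 2) (μ := (volume : Measure Torus)) f] with x h1 h2
  rw [h1, h2]; simp

theorem norm_synth_le (a : FourierSeq) : ‖synth a‖ ≤ ‖a‖ := by
  have h : synth a = Complex.reCLM.compLp (torusBasis.repr.symm a) := rfl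
  rw [h]
  refine (Complex.reCLM.norm_compLp_le _).trans ?_
  simp

theorem norm_coeffs_le (f : L2) : ‖coeffs f‖ ≤ ‖f‖ := by
  have h : coeffs f = torusBasis.repr (Complex.ofRealCLM.compLp f) := rfl
  rw [h, LinearIsometryEquiv.norm_map]
  refine (Complex.ofRealCLM.norm_compLp_le _).trans ?_
  simp

/-- The real trigonometric monomial `Re (z e^{i n·x})`. -/
def trig (z : ℂ) (n : Fin 3 → ℤ) (x : Torus) : ℝ := (z * monomial n x).re

theorem monomial_torusMk (n : Fin 3 → ℤ) (y : Fin 3 → ℝ) :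
    monomial n (torusMk y) = Complex.exp (Complex.I * ∑ i, (n i : ℂ) * y i) := by
  have h := Real.pi_pos.ne'
  have h' : (Real.pi : ℂ) ≠ 0 := by exact_mod_cast h
  rw [monomial_apply, Finset.mul_sum, Complex.exp_sum]
  refine Finset.prod_congr rfl fun i _ => ?_
  rw [torusMk, fourier_coe_apply]
  congr 1
  push_cast
  field_simp

theorem smoothFn_trig (z : ℂ) (n : Fin 3 → ℤ) : SmoothFn (trig z n) := by
  rw [smoothFn_iff]
  have h : trig z n ∘ torusMk
      = fun y => Complex.reCLM (z * Complex.exp (Complex.I * ∑ i, (n i : ℂ) * Complex.ofRealCLM (y i))) := by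
    funext y
    simp [trig, monomial_torusMk]
  rw [h]
  fun_prop

theorem partialDeriv_trig (z : ℂ) (n : Fin 3 → ℤ) (j : Fin 3) :
    partialDeriv j (trig z n) = trig (Complex.I * n j * z) n := by
  funext x
  apply partialDeriv_eq_of_hasDerivAt
  obtain ⟨y, rfl⟩ := isOpenQuotientMap_torusMk.surjective x
  have h1 : ∀ s : ℝ, trig z n (torusMk y + Pi.single j (s : AddCircle (2 * Real.pi)))
      = (z * monomial n (torusMk y) * Complex.exp (Complex.I * n j * (s : ℂ))).re := by
    intro s
    rw [torusMk_add_single, trig, monomial_torusMk, monomial_torusMk, mul_assoc, ← Complex.exp_add]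
    congr 3
    simp only [Pi.add_apply, Pi.smul_apply, smul_eq_mul, Complex.ofReal_add, Complex.ofReal_mul,
      mul_add, Finset.sum_add_distrib, Finset.mul_sum]
    congr 1
    rw [Finset.sum_eq_single j]
    · simp; ring
    · intro b _ hb; simp [hb]
    · simp
  simp_rw [h1]
  have h2 : HasDerivAt (fun s : ℂ => z * monomial n (torusMk y) *
      Complex.exp (Complex.I * n j * s))
      (z * monomial n (torusMk y) * (Complex.exp (Complex.I * n j * ((0 : ℝ) : ℂ))
        * (Complex.I * n j))) ((0 : ℝ) : ℂ) := by
    have := ((hasDerivAt_id (((0 : ℝ) : ℂ))).const_mul (Complex.I * n j)).cexp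
    simpa using this.const_mul (z * monomial n (torusMk y))
  have h3 := h2.real_of_complex
  convert h3 using 1
  simp only [trig, Complex.ofReal_zero, mul_zero, Complex.exp_zero, one_mul]
  congr 1; ring

theorem synth_single (n : Fin 3 → ℤ) (z : ℂ) :
    synth (lp.single 2 n z) = toL2 (trig (monomialScale * z) n) := by
  have h : synth (lp.single 2 n z) = Complex.reCLM.compLp (torusBasis.repr.symm (lp.single 2 n z)) :=
    rfl
  have h2 : torusBasis.repr.symm (lp.single 2 n z) = z • monomialL2 n := by
    have : (lp.single 2 n z : FourierSeq) = z • lp.single 2 n (1 : ℂ) := by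
      rw [← lp.single_smul]; simp
    rw [this, map_smul, HilbertBasis.repr_symm_single, torusBasis_apply]
  rw [h, h2, monomialL2, smul_smul]
  apply Lp.ext
  filter_upwards [Complex.reCLM.coeFn_compLp ((z * (monomialScale : ℂ)) •
      ContinuousMap.toLp (E := ℂ) 2 (volume : Measure Torus) ℂ (monomial n)),
    Lp.coeFn_smul (z * (monomialScale : ℂ))
      (ContinuousMap.toLp (E := ℂ) 2 (volume : Measure Torus) ℂ (monomial n)),
    ContinuousMap.coeFn_toLp (p := 2) (𝕜 := ℂ) (volume : Measure Torus) (monomial n),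
    toL2_coe ((smoothFn_trig (monomialScale * z) n).memLp 2)] with x h1 h2 h3 h4
  rw [h1, h2, h4, Pi.smul_apply, h3, trig, smul_eq_mul, mul_comm z]
  rfl

theorem hasSum_synth (a : FourierSeq) :
    HasSum (fun n => toL2 (trig (monomialScale * a n) n)) (synth a) := by
  have h := (lp.hasSum_single (p := 2) (by simp) a).mapL synth
  simpa only [synth_single] using h

/-- Pairing with real trigonometric monomials sees only a real part; the choices z = 1 and z = i
together recover the complex Fourier coefficient. -/
theorem inner_trig (z : ℂ) (n : Fin 3 → ℤ) (f : L2) :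
    inner ℝ (toL2 (trig z n)) f
      = monomialScale⁻¹ * (z * starRingEnd ℂ (coeffs f n)).re := by
  rw [inner_toL2 ((smoothFn_trig z n).memLp 2)]
  have h1 : coeffs f n = inner ℂ (monomialL2 n) (Complex.ofRealCLM.compLp f) := by
    rw [← torusBasis_apply, ← HilbertBasis.repr_apply_apply]; rfl
  have h2 : starRingEnd ℂ (coeffs f n) = monomialScale * ∫ x, (f x : ℂ) * monomial n x := by
    rw [h1, inner_conj_symm, monomialL2, inner_smul_right, L2.inner_def]
    congr 1
    apply integral_congr_ae
    filter_upwards [Complex.ofRealCLM.coeFn_compLp f,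
      ContinuousMap.coeFn_toLp (p := 2) (𝕜 := ℂ) (volume : Measure Torus) (monomial n)] with x h3 h4
    rw [h3, h4]; simp [mul_comm]
  have hi : Integrable (fun x => (f x : ℂ) * monomial n x) := by
    have h5 : Integrable (fun x => (f x : ℂ)) :=
      ((Lp.memLp f).integrable (by norm_num)).ofReal
    obtain ⟨C, hC⟩ := isCompact_univ.exists_bound_of_continuousOn (monomial n).continuous.continuousOn
    exact h5.mul_bdd (c := C) (monomial n).continuous.aestronglyMeasurable
      (Eventually.of_forall fun x => hC x (Set.mem_univ _))
  rw [h2, mul_left_comm, Complex.re_ofReal_mul, ← mul_assoc,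
    inv_mul_cancel₀ monomialScale_pos.ne', one_mul, ← integral_const_mul, ← RCLike.re_to_complex,
    ← integral_re (hi.const_mul z)]
  apply integral_congr_ae
  refine Eventually.of_forall fun x => ?_
  simp only [trig, RCLike.re_to_complex]
  rw [mul_left_comm, Complex.re_ofReal_mul]

/-- The partial sums are trigonometric polynomials, whose classical derivatives have the right
coefficients; both series converge in L² and the weak derivative is closed. -/
theorem hasWeakDeriv_synth {j : Fin 3} {a b : FourierSeq}
    (h : ∀ n, b n = Complex.I * n j * a n) : HasWeakDeriv j (synth a) (synth b) := by
  refine hasWeakDeriv_of_tendsto (hasSum_synth a) (hasSum_synth b) fun s => ?_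
  induction s using Finset.cons_induction with
  | empty =>
    rw [hasWeakDeriv_iff]
    simp
  | cons n s hn ih =>
    simp only [Finset.sum_cons]
    refine HasWeakDeriv.add ?_ ih
    have := (smoothFn_trig (monomialScale * a n) n).hasWeakDeriv j
    rwa [partialDeriv_trig, mul_left_comm, ← h] at this

/-- Trigonometric monomials are admissible test functions, so a weak derivative has prescribed
Fourier coefficients. Uniqueness follows, and with it the independence of `weakDeriv` from the
choice in its definition. -/
theorem HasWeakDeriv.coeffs_eq {j : Fin 3} {f g : L2} (h : HasWeakDeriv j f g) (n : Fin 3 → ℤ) :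
    coeffs g n = Complex.I * n j * coeffs f n := by
  have key : ∀ z : ℂ, (Complex.I * n j * z * starRingEnd ℂ (coeffs f n)).re
      = - (z * starRingEnd ℂ (coeffs g n)).re := by
    intro z
    have := hasWeakDeriv_iff.1 h (trig z n) (smoothFn_trig z n)
    rw [partialDeriv_trig, inner_trig, inner_trig, ← mul_neg] at this
    exact mul_left_cancel₀ (inv_ne_zero monomialScale_pos.ne') this
  have k1 := key 1
  have k2 := key Complex.I
  apply Complex.ext <;> simp at k1 k2 ⊢ <;> linarith

/-! ### Uniqueness and calculus of weak derivatives -/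

theorem HasWeakDeriv.unique {j : Fin 3} {f g g' : L2} (h : HasWeakDeriv j f g)
    (h' : HasWeakDeriv j f g') : g = g' := by
  rw [← synth_coeffs g, ← synth_coeffs g']
  congr 1
  ext n
  rw [h.coeffs_eq, h'.coeffs_eq]

theorem HasWeakDeriv.weakDeriv_eq {j : Fin 3} {f g : L2} (h : HasWeakDeriv j f g) :
    weakDeriv j f = g := by
  have hex : ∃ g, HasWeakDeriv j f g := ⟨g, h⟩
  rw [weakDeriv, dif_pos hex]
  exact hex.choose_spec.unique h

theorem MemH1.hasWeakDeriv {f : L2} (h : MemH1 f) (j : Fin 3) :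
    HasWeakDeriv j f (weakDeriv j f) := by
  obtain ⟨g, hg⟩ := h j
  rwa [hg.weakDeriv_eq]

theorem MemH1.add {f g : L2} (hf : MemH1 f) (hg : MemH1 g) : MemH1 (f + g) :=
  fun j => ⟨_, (hf.hasWeakDeriv j).add (hg.hasWeakDeriv j)⟩

theorem MemH1.smul {f : L2} (c : ℝ) (hf : MemH1 f) : MemH1 (c • f) :=
  fun j => ⟨_, (hf.hasWeakDeriv j).smul c⟩

theorem MemH1.neg {f : L2} (hf : MemH1 f) : MemH1 (-f) := by
  simpa using hf.smul (-1)

theorem MemH1.sub {f g : L2} (hf : MemH1 f) (hg : MemH1 g) : MemH1 (f - g) := by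
  rw [sub_eq_add_neg]; exact hf.add hg.neg

theorem weakDeriv_add {f g : L2} (hf : MemH1 f) (hg : MemH1 g) (j : Fin 3) :
    weakDeriv j (f + g) = weakDeriv j f + weakDeriv j g :=
  ((hf.hasWeakDeriv j).add (hg.hasWeakDeriv j)).weakDeriv_eq

theorem weakDeriv_smul {f : L2} (hf : MemH1 f) (c : ℝ) (j : Fin 3) :
    weakDeriv j (c • f) = c • weakDeriv j f :=
  ((hf.hasWeakDeriv j).smul c).weakDeriv_eq

theorem weakDeriv_sub {f g : L2} (hf : MemH1 f) (hg : MemH1 g) (j : Fin 3) :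
    weakDeriv j (f - g) = weakDeriv j f - weakDeriv j g := by
  have := weakDeriv_add hf (hg.smul (-1)) j
  rw [weakDeriv_smul hg] at this
  simpa [sub_eq_add_neg] using this

/-- Smooth functions are dense in `H¹`. -/
theorem MemH1.exists_smooth {f : L2} (hf : MemH1 f) : ∃ φ : ℕ → Torus → ℝ,
    (∀ k, SmoothFn (φ k)) ∧ Tendsto (fun k => toL2 (φ k)) atTop (𝓝 f) ∧
    ∀ j, Tendsto (fun k => toL2 (partialDeriv j (φ k))) atTop (𝓝 (weakDeriv j f)) := by
  have hp : ∀ s : Finset (Fin 3 → ℤ), ∃ φ : Torus → ℝ, SmoothFn φ ∧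
      toL2 φ = ∑ n ∈ s, toL2 (trig (monomialScale * coeffs f n) n) ∧
      ∀ j, toL2 (partialDeriv j φ)
        = ∑ n ∈ s, toL2 (trig (monomialScale * coeffs (weakDeriv j f) n) n) := by
    intro s
    have hφ : SmoothFn (fun x => ∑ n ∈ s, trig (monomialScale * coeffs f n) n x) :=
      SmoothFn.sum s fun n _ => smoothFn_trig _ n
    have hadd : ∀ z : (Fin 3 → ℤ) → ℂ, toL2 (fun x => ∑ n ∈ s, trig (z n) n x)
        = ∑ n ∈ s, toL2 (trig (z n) n) := by
      intro z
      have hφ : SmoothFn (fun x => ∑ n ∈ s, trig (z n) n x) :=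
        SmoothFn.sum s fun n _ => smoothFn_trig _ n
      apply Lp.ext
      have hs : ∀ᵐ x, ∀ n ∈ s, (toL2 (trig (z n) n) : Torus → ℝ) x = trig (z n) n x :=
        (ae_ball_iff s.countable_toSet).2 fun n _ => toL2_coe ((smoothFn_trig _ n).memLp 2)
      filter_upwards [toL2_coe (hφ.memLp 2), Lp.coeFn_finsetSum s (fun n => toL2 (trig (z n) n)),
        hs] with x h1 h2 h3
      rw [h1, h2]
      simp only [Finset.sum_apply]
      exact Finset.sum_congr rfl fun n hn => (h3 n hn).symm
    refine ⟨_, hφ, hadd _, fun j => ?_⟩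
    rw [← hadd]
    congr 1
    funext x
    apply partialDeriv_eq_of_hasDerivAt
    -- Differentiation multiplies the n-th mode by i n_j, so the derivative of a partial sum for `f`
    -- is the same partial sum for `weakDeriv j f`. One sequence thus approximates `f` and all its
    -- derivatives.
    refine HasDerivAt.fun_sum fun n _ => ?_
    have := (smoothFn_trig (monomialScale * coeffs f n) n).hasDerivAt_zero j x
    rwa [partialDeriv_trig, mul_left_comm, ← (hf.hasWeakDeriv j).coeffs_eq] at this
  choose Φ hΦ using hp
  obtain ⟨s, hs⟩ := exists_seq_tendsto (atTop : Filter (Finset (Fin 3 → ℤ)))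
  refine ⟨fun k => Φ (s k), fun k => (hΦ _).1, ?_, fun j => ?_⟩
  · have := (hasSum_synth (coeffs f)).comp hs
    rw [synth_coeffs] at this
    exact this.congr fun k => ((hΦ _).2.1).symm
  · have := (hasSum_synth (coeffs (weakDeriv j f))).comp hs
    rw [synth_coeffs] at this
    exact this.congr fun k => ((hΦ _).2.2 j).symm

theorem inner_weakDeriv {f g : L2} (hf : MemH1 f) (hg : MemH1 g) (j : Fin 3) :
    inner ℝ (weakDeriv j f) g = - inner ℝ f (weakDeriv j g) := by
  obtain ⟨φ, h1, h2, h3⟩ := hf.exists_smooth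
  refine tendsto_nhds_unique ((h3 j).inner tendsto_const_nhds)
    ((h2.inner (tendsto_const_nhds (x := weakDeriv j g))).neg.congr fun k => ?_)
  exact (hasWeakDeriv_iff.1 (hg.hasWeakDeriv j) _ (h1 k)).symm


/-! ## Constants and mean values -/

/-- The constant function `1` in `L²`. -/
def oneL2 : L2 := toL2 (fun _ => 1)

theorem zeroMean_iff {f : L2} : ZeroMean f ↔ inner ℝ oneL2 f = 0 := by
  rw [oneL2, inner_toL2 ((smoothFn_const 1).memLp 2), ZeroMean]
  simp

theorem hasWeakDeriv_oneL2 (j : Fin 3) : HasWeakDeriv j oneL2 0 := by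
  have h := (smoothFn_const 1).hasWeakDeriv j
  have h2 : partialDeriv j (fun _ => (1 : ℝ)) = fun _ => 0 := by
    funext x
    exact partialDeriv_eq_of_hasDerivAt (hasDerivAt_const _ _)
  have h3 : toL2 (fun _ => 0) = 0 := by
    apply Lp.ext
    filter_upwards [toL2_coe ((smoothFn_const 0).memLp 2),
      Lp.coeFn_zero ℝ 2 (volume : Measure Torus)] with x h1 h2
    rw [h1, h2]; rfl
  rwa [h2, h3] at h

/-- The projection onto constants is subtracted: by Pythagoras the norm does not grow, derivatives
are unchanged, and functions of zero mean do not notice. It reduces arbitrary H¹ test functions to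
zero mean ones, for which the assumptions on π_h are made. -/
theorem MemH1.exists_sub_mean {f : L2} (hf : MemH1 f) : ∃ f' : L2, MemH1 f' ∧ ZeroMean f' ∧
    ‖f'‖ ≤ ‖f‖ ∧ (∀ j, weakDeriv j f' = weakDeriv j f) ∧
    ∀ g : L2, ZeroMean g → inner ℝ g f' = inner ℝ g f := by
  have h1 : MemH1 oneL2 := fun j => ⟨0, hasWeakDeriv_oneL2 j⟩
  obtain ⟨c, hc⟩ := Submodule.mem_span_singleton.1
    ((Submodule.span ℝ {oneL2}).starProjection_apply_mem f)
  have hz := (Submodule.span ℝ {oneL2}).starProjection_inner_eq_zero f oneL2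
    (Submodule.mem_span_singleton_self _)
  rw [← hc] at hz
  have hz' : inner ℝ oneL2 (f - c • oneL2) = 0 := by rwa [real_inner_comm]
  refine ⟨f - c • oneL2, hf.sub (h1.smul c), zeroMean_iff.2 hz', ?_, fun j => ?_, fun g hg => ?_⟩
  · have : ‖f‖ * ‖f‖ = ‖f - c • oneL2‖ * ‖f - c • oneL2‖ + ‖c • oneL2‖ * ‖c • oneL2‖ := by
      rw [← norm_add_sq_eq_norm_sq_add_norm_sq_of_inner_eq_zero _ _
        (by rw [inner_smul_right, hz, mul_zero]), sub_add_cancel]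
    exact abs_le_of_sq_le_sq' (by nlinarith [norm_nonneg (c • oneL2)]) (norm_nonneg _) |>.2
  · rw [weakDeriv_sub hf (h1.smul c), weakDeriv_smul h1, (hasWeakDeriv_oneL2 j).weakDeriv_eq]
    simp
  · rw [zeroMean_iff, real_inner_comm] at hg
    rw [inner_sub_right, inner_smul_right, hg]; simp

/-! ## The Poisson problem -/

theorem norm_grad_sq (q : L2) : ‖grad q‖ ^ 2 = ∑ i, ‖weakDeriv i q‖ ^ 2 := by
  rw [PiLp.norm_sq_eq_of_L2]; rfl

theorem inner_grad (q : L2) (w : VecL2) :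
    inner ℝ (grad q) w = ∑ i, inner ℝ (weakDeriv i q) (w i) := by
  rw [PiLp.inner_apply]; rfl

theorem coeffs_zero_of_zeroMean {f : L2} (hf : ZeroMean f) : coeffs f 0 = 0 := by
  have key : ∀ z : ℂ, (z * starRingEnd ℂ (coeffs f 0)).re = 0 := by
    intro z
    have h := inner_trig z 0 f
    rw [inner_toL2 ((smoothFn_trig z 0).memLp 2)] at h
    have h2 : ∀ x, trig z 0 x = z.re := fun x => by simp [trig, monomial_zero]
    simp_rw [h2] at h
    rw [integral_mul_const, show ∫ x, f x = 0 from hf, zero_mul] at h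
    exact (mul_eq_zero.1 h.symm).resolve_left (inv_ne_zero monomialScale_pos.ne')
  have k1 := key 1
  have k2 := key Complex.I
  apply Complex.ext <;> simp at k1 k2 ⊢ <;> linarith

theorem zeroMean_synth {a : FourierSeq} (ha : a 0 = 0) : ZeroMean (synth a) := by
  rw [zeroMean_iff]
  have h := (hasSum_synth a).mapL (innerSL ℝ oneL2)
  have h0 : ∀ n, innerSL ℝ oneL2 (toL2 (trig (monomialScale * a n) n)) = 0 := by
    intro n
    have hi : Integrable (fun x => monomialScale * a n * monomial n x) :=
      (by fun_prop : Continuous _).integrable_of_hasCompactSupport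
        (HasCompactSupport.of_compactSpace _)
    rw [innerSL_apply_apply, real_inner_comm, inner_toL2 ((smoothFn_trig _ n).memLp 2)]
    have : ∫ x, oneL2 x * trig (monomialScale * a n) n x
        = ∫ x, (monomialScale * a n * monomial n x).re := by
      apply integral_congr_ae
      filter_upwards [toL2_coe ((smoothFn_const 1).memLp 2)] with x hx
      rw [oneL2, hx, one_mul, trig]
    rw [this]
    have h3 := integral_re hi
    simp only [RCLike.re_to_complex] at h3
    rw [h3, integral_const_mul, integral_monomial]
    split_ifs with hn
    · subst hn; simp [ha]
    · simp
  simp_rw [h0] at h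
  exact h.unique hasSum_zero

/-- The Fourier multiplier with bounded symbol `m`. -/
def multiplier (m : (Fin 3 → ℤ) → ℂ) (hm : ∀ n, ‖m n‖ ≤ 1) (c : FourierSeq) : FourierSeq :=
  ⟨fun n => m n * c n, Memℓp.mono' (lp.memℓp c) fun n => by
    rw [norm_mul]; exact mul_le_of_le_one_left (norm_nonneg _) (hm n)⟩

theorem multiplier_apply (m : (Fin 3 → ℤ) → ℂ) (hm : ∀ n, ‖m n‖ ≤ 1) (c : FourierSeq)
    (n : Fin 3 → ℤ) : multiplier m hm c n = m n * c n := rfl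

theorem norm_multiplier_le (m : (Fin 3 → ℤ) → ℂ) (hm : ∀ n, ‖m n‖ ≤ 1) (c : FourierSeq) :
    ‖multiplier m hm c‖ ≤ ‖c‖ :=
  lp.norm_mono (by norm_num) fun n => by
    rw [multiplier_apply, norm_mul]; exact mul_le_of_le_one_left (norm_nonneg _) (hm n)

theorem norm_synth_multiplier_le (m : (Fin 3 → ℤ) → ℂ) (hm : ∀ n, ‖m n‖ ≤ 1) (p : L2) :
    ‖synth (multiplier m hm (coeffs p))‖ ≤ ‖p‖ :=
  (norm_synth_le _).trans ((norm_multiplier_le _ _ _).trans (norm_coeffs_le _))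

/-- Elliptic regularity: the solution `q` of `-Δ q = p` for `p` with zero mean. -/
theorem exists_poisson {p : L2} (hp : ZeroMean p) : ∃ q : L2, MemH2 q ∧ ZeroMean q ∧
    h2Norm q ≤ 4 * ‖p‖ ∧ ∀ r, MemH1 r → inner ℝ (grad q) (grad r) = inner ℝ p r := by
  let S : (Fin 3 → ℤ) → ℝ := fun n => ∑ i, (n i : ℝ) ^ 2
  have hS0 : ∀ n, 0 ≤ S n := fun n => Finset.sum_nonneg fun i _ => sq_nonneg _
  have hSi : ∀ n i, (n i : ℝ) ^ 2 ≤ S n := fun n i =>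
    Finset.single_le_sum (f := fun i => (n i : ℝ) ^ 2) (fun i _ => sq_nonneg _) (Finset.mem_univ i)
  -- Integrality of frequencies: it lets |n|² dominate the first powers |n_i| as well, so all the
  -- symbols below are bounded by 1.
  have hi : ∀ (n : Fin 3 → ℤ) i, |(n i : ℝ)| ≤ (n i : ℝ) ^ 2 := by
    intro n i
    have : |n i| ≤ n i ^ 2 := by
      rw [← sq_abs]; nlinarith [Int.le_self_sq |n i|]
    exact_mod_cast this
  have m0 : ∀ n, ‖((S n : ℂ))⁻¹‖ ≤ 1 := by
    intro n
    rw [norm_inv, Complex.norm_real, Real.norm_of_nonneg (hS0 n)]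
    -- The convention 0⁻¹ = 0 drops the zero mode, which makes the solution have zero mean.
    by_cases h : n = 0
    · subst h; simp [S]
    · obtain ⟨i, hi'⟩ := Function.ne_iff.1 h
      have h1 : (1 : ℝ) ≤ |(n i : ℝ)| := by exact_mod_cast Int.one_le_abs hi'
      exact inv_le_one_of_one_le₀ (h1.trans ((hi n i).trans (hSi n i)))
  have m1 : ∀ j n, ‖Complex.I * n j * ((S n : ℂ))⁻¹‖ ≤ 1 := by
    intro j n
    rw [norm_mul, norm_mul, norm_inv, Complex.norm_real, Real.norm_of_nonneg (hS0 n),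
      Complex.norm_I, one_mul, Complex.norm_intCast, ← div_eq_mul_inv]
    exact div_le_one_of_le₀ ((hi n j).trans (hSi n j)) (hS0 n)
  have m2 : ∀ k j n, ‖Complex.I * n k * (Complex.I * n j * ((S n : ℂ))⁻¹)‖ ≤ 1 := by
    intro k j n
    rw [norm_mul, norm_mul, norm_mul, norm_mul, norm_inv, Complex.norm_real,
      Real.norm_of_nonneg (hS0 n), Complex.norm_I, one_mul, one_mul, Complex.norm_intCast,
      Complex.norm_intCast, ← mul_assoc, ← div_eq_mul_inv]
    refine div_le_one_of_le₀ ?_ (hS0 n)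
    have h1 := hSi n k
    have h2 := hSi n j
    rw [← sq_abs] at h1 h2
    nlinarith [sq_nonneg (|(n k : ℝ)| - |(n j : ℝ)|)]
  have d1 : ∀ j, HasWeakDeriv j (synth (multiplier _ m0 (coeffs p)))
      (synth (multiplier _ (m1 j) (coeffs p))) := fun j =>
    hasWeakDeriv_synth fun n => by simp only [multiplier_apply]; ring
  have d2 : ∀ k j, HasWeakDeriv k (synth (multiplier _ (m1 j) (coeffs p)))
      (synth (multiplier _ (m2 k j) (coeffs p))) := fun k j =>
    hasWeakDeriv_synth fun n => by simp only [multiplier_apply]; ring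
  have hc0 := coeffs_zero_of_zeroMean hp
  -- The symbol of the Laplacian of the solution is -1 off the zero mode; at the zero mode `p`
  -- itself has no coefficient.
  have hlap : ∑ j, synth (multiplier _ (m2 j j) (coeffs p)) = - p := by
    rw [← map_sum, ← synth_coeffs (-p), map_neg]
    congr 1
    ext n
    rw [lp.coeFn_sum, Finset.sum_apply, lp.coeFn_neg, Pi.neg_apply]
    simp only [multiplier_apply]
    by_cases h : n = 0
    · subst h; simp [hc0]
    · have hne : (S n : ℂ) ≠ 0 := by
        intro h0
        obtain ⟨i, hi'⟩ := Function.ne_iff.1 h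
        have h1 : (1 : ℝ) ≤ |(n i : ℝ)| := by exact_mod_cast Int.one_le_abs hi'
        have h2 := h1.trans ((hi n i).trans (hSi n i))
        rw [Complex.ofReal_eq_zero] at h0
        linarith
      have h3 : ∀ j : Fin 3, Complex.I * n j * (Complex.I * n j * ((S n : ℂ))⁻¹) * coeffs p n
          = (n j : ℂ) ^ 2 * (- ((S n : ℂ))⁻¹ * coeffs p n) := by
        intro j
        linear_combination (n j : ℂ) ^ 2 * ((S n : ℂ))⁻¹ * coeffs p n * Complex.I_sq
      simp_rw [h3]
      rw [← Finset.sum_mul]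
      have h4 : ∑ j, (n j : ℂ) ^ 2 = S n := by simp [S]
      rw [h4]; field_simp
  have w1 := fun j => (d1 j).weakDeriv_eq
  have w2 := fun k j => (d2 k j).weakDeriv_eq
  set q := synth (multiplier _ m0 (coeffs p)) with hq
  have hq1 : MemH1 q := fun j => ⟨_, d1 j⟩
  have hq2 : ∀ i, MemH1 (weakDeriv i q) := fun i j => ⟨_, by rw [w1]; exact d2 j i⟩
  refine ⟨q, ⟨hq1, hq2⟩, zeroMean_synth (by rw [multiplier_apply, hc0, mul_zero]), ?_, ?_⟩
  -- There are 1 + 3 + 9 = 13 terms, each at most ‖p‖², and 13 ≤ 4².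
  · rw [h2Norm]
    refine Real.sqrt_le_iff.2 ⟨by positivity, ?_⟩
    have hb : ∀ m hm, ‖synth (multiplier m hm (coeffs p))‖ ^ 2 ≤ ‖p‖ ^ 2 := fun m hm =>
      pow_le_pow_left₀ (norm_nonneg _) (norm_synth_multiplier_le m hm p) 2
    simp only [norm_grad_sq, w1, w2, Fin.sum_univ_three]
    have := hb _ m0
    have b1 := fun j => hb _ (m1 j)
    have b2 := fun k j => hb _ (m2 k j)
    linarith [b1 0, b1 1, b1 2, b2 0 0, b2 0 1, b2 0 2, b2 1 0, b2 1 1, b2 1 2, b2 2 0, b2 2 1,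
      b2 2 2, sq_nonneg ‖p‖]
  · intro r hr
    rw [inner_grad]
    have h5 : ∀ i, inner ℝ (weakDeriv i q) (grad r i)
        = - inner ℝ (synth (multiplier _ (m2 i i) (coeffs p))) r := by
      intro i
      have := inner_weakDeriv (hq2 i) hr i
      rw [w1 i, w2 i i] at this
      rw [w1 i]
      change inner ℝ _ (weakDeriv i r) = _
      linarith
    simp_rw [h5]
    rw [Finset.sum_neg_distrib, ← sum_inner, hlap, inner_neg_left, neg_neg]


/-! ## The Sobolev embedding `H¹ ⊆ L⁶` -/

theorem lintegral_enorm_pow {α : Type*} [MeasurableSpace α] (μ : Measure α) (f : α → ℝ) {k : ℕ}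
    (hk : k ≠ 0) : ∫⁻ x, ‖f x‖ₑ ^ k ∂μ = eLpNorm f k μ ^ k := by
  have hk' : (k : ℝ) ≠ 0 := by exact_mod_cast hk
  rw [eLpNorm_eq_lintegral_rpow_enorm_toReal (by exact_mod_cast hk) (ENNReal.natCast_ne_top k),
    ENNReal.toReal_natCast, ← ENNReal.rpow_natCast, ← ENNReal.rpow_mul, one_div,
    inv_mul_cancel₀ hk', ENNReal.rpow_one]
  simp_rw [ENNReal.rpow_natCast]

/-- The fundamental theorem of calculus along the i-th circle bounds |φ(x)| by |φ| at any other
point of the circle plus the integral of |∂ᵢφ|; then average over that point. -/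
theorem SmoothFn.enorm_le_lintegral_update {φ : Torus → ℝ} (h : SmoothFn φ) (i : Fin 3)
    (x : Torus) : ‖φ x‖ₑ ≤ ∫⁻ s : AddCircle (2 * Real.pi), (‖φ (Function.update x i s)‖ₑ
      + ‖CrankNicolsonNSE.partialDeriv i φ (Function.update x i s)‖ₑ) := by
  set φ' := CrankNicolsonNSE.partialDeriv i φ with hφ'
  have hc' : Continuous φ' := (h.partialDeriv i).continuous
  let γ : ℝ → Torus := fun r => x + Pi.single i (r : AddCircle (2 * Real.pi))
  have hγ : Continuous γ :=
    continuous_const.add ((continuous_single i).comp (AddCircle.continuous_mk' _))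
  have hγ0 : γ 0 = x := by simp [γ]
  have hupd : ∀ r : ℝ, Function.update x i (x i + (r : AddCircle (2 * Real.pi))) = γ r := by
    intro r
    ext k
    by_cases hk : k = i
    · subst hk; simp [γ]
    · simp [γ, hk]
  have htr : ∀ F : Torus → ℝ≥0∞, ∫⁻ s : AddCircle (2 * Real.pi), F (Function.update x i s)
      = ∫⁻ r in Set.Ioc 0 (2 * Real.pi), F (γ r) := by
    intro F
    rw [← lintegral_add_left_eq_self (fun s => F (Function.update x i s)) (x i),
      ← AddCircle.lintegral_preimage (2 * Real.pi) 0, zero_add]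
    simp_rw [hupd]
  rw [htr (fun y => ‖φ y‖ₑ + ‖φ' y‖ₑ), lintegral_add_left
    (show Measurable fun r => ‖φ (γ r)‖ₑ from (h.continuous.comp hγ).measurable.enorm)]
  set D := ∫⁻ r in Set.Ioc 0 (2 * Real.pi), ‖φ' (γ r)‖ₑ with hD
  have hpt : ∀ r ∈ Set.Ioc 0 (2 * Real.pi), ‖φ x‖ₑ ≤ ‖φ (γ r)‖ₑ + D := by
    intro r hr
    have hi : IntervalIntegrable (fun s => φ' (γ s)) volume 0 r :=
      (hc'.comp hγ).intervalIntegrable _ _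
    have hft := intervalIntegral.integral_eq_sub_of_hasDerivAt
      (fun s _ => h.hasDerivAt i x s) hi
    change _ = φ (γ r) - φ (γ 0) at hft
    rw [hγ0] at hft
    have he : φ x = φ (γ r) - ∫ s in (0 : ℝ)..r, φ' (γ s) := by linarith
    rw [he]
    refine enorm_sub_le.trans (add_le_add le_rfl ?_)
    rw [intervalIntegral.integral_of_le hr.1.le]
    refine (enorm_integral_le_lintegral_enorm _).trans ?_
    exact lintegral_mono_set (Set.Ioc_subset_Ioc_right hr.2)
  -- Integration over the other point produces the length 2π on the left and in front of `D`; since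
  -- 2π ≥ 1 it may be inserted in front of ∫ |φ| too, and cancelled.
  have hint := setLIntegral_mono' (μ := volume) measurableSet_Ioc hpt
  have hpi : (1 : ℝ≥0∞) ≤ ENNReal.ofReal (2 * Real.pi) := by
    rw [← ENNReal.ofReal_one]
    exact ENNReal.ofReal_le_ofReal (by linarith [Real.pi_gt_three])
  rw [lintegral_add_right _ measurable_const] at hint
  simp only [lintegral_const, Measure.restrict_apply MeasurableSet.univ, Set.univ_inter,
    Real.volume_Ioc, sub_zero] at hint
  refine (ENNReal.mul_le_mul_iff_left (zero_lt_one.trans_le hpi).ne' ENNReal.ofReal_ne_top).1 ?_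
  refine hint.trans ?_
  rw [add_mul]
  gcongr
  exact le_mul_of_one_le_right' hpi

/-- Gagliardo–Nirenberg, W^{1,1} ⊆ L^{3/2}: |φ|^{3/2} is a product of three factors |φ|^{1/2}, the
i-th bounded by a function independent of x_i, and the grid-lines inequality integrates such
products. -/
theorem SmoothFn.lintegral_rpow_le {φ : Torus → ℝ} (h : SmoothFn φ) :
    ∫⁻ x, ‖φ x‖ₑ ^ (3 / 2 : ℝ) ≤ (∫⁻ x, (‖φ x‖ₑ
      + ∑ j, ‖CrankNicolsonNSE.partialDeriv j φ x‖ₑ)) ^ (3 / 2 : ℝ) := by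
  have hm : Measurable (fun x => ‖φ x‖ₑ + ∑ j, ‖CrankNicolsonNSE.partialDeriv j φ x‖ₑ) :=
    h.continuous.measurable.enorm.add (Finset.measurable_sum _ fun j _ =>
      (h.partialDeriv j).continuous.measurable.enorm)
  have hp : Real.HolderConjugate (Fintype.card (Fin 3)) (3 / 2) := by
    rw [Real.holderConjugate_iff]; norm_num
  refine le_trans (lintegral_mono fun x => ?_) (lintegral_prod_lintegral_pow_le
    (fun _ : Fin 3 => (volume : Measure (AddCircle (2 * Real.pi)))) hp hm)
  have hb : ∀ i, ‖φ x‖ₑ ≤ ∫⁻ s : AddCircle (2 * Real.pi), (‖φ (Function.update x i s)‖ₑ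
      + ∑ j, ‖CrankNicolsonNSE.partialDeriv j φ (Function.update x i s)‖ₑ) := fun i =>
    (h.enorm_le_lintegral_update i x).trans (lintegral_mono fun s => add_le_add le_rfl
      (Finset.single_le_sum (f := fun j =>
        ‖CrankNicolsonNSE.partialDeriv j φ (Function.update x i s)‖ₑ)
        (fun _ _ => zero_le) (Finset.mem_univ i)))
  have he : ‖φ x‖ₑ ^ (3 / 2 : ℝ)
      = ∏ _i : Fin 3, ‖φ x‖ₑ ^ ((1 : ℝ) / ((Fintype.card (Fin 3) : ℝ) - 1)) := by
    rw [Finset.prod_const, ← ENNReal.rpow_natCast, ← ENNReal.rpow_mul]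
    norm_num
  rw [he]
  exact Finset.prod_le_prod' fun i _ => ENNReal.rpow_le_rpow (hb i) (by norm_num)

/-- The quantity `‖f‖₂ + 4 ∑ⱼ ‖∂ⱼ f‖₂`, which controls the norm of `f` in `L⁶`. -/
def sobNorm (f : L2) : ℝ := ‖f‖ + 4 * ∑ j, ‖weakDeriv j f‖

theorem sobNorm_nonneg (f : L2) : 0 ≤ sobNorm f := by unfold sobNorm; positivity

theorem eLpNorm_toL2 {φ : Torus → ℝ} (h : MemLp φ 2 (volume : Measure Torus)) :
    eLpNorm φ 2 volume = ENNReal.ofReal ‖toL2 φ‖ := by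
  rw [Lp.norm_def, ENNReal.ofReal_toReal (Lp.eLpNorm_ne_top _)]
  exact (eLpNorm_congr_ae (toL2_coe h)).symm

/-- The W^{1,1} inequality is applied to φ⁴. As ∇(φ⁴) = 4φ³∇φ, its right side is the integral of
|φ|³ B, and Cauchy–Schwarz gives ‖φ‖₆⁶ ≤ (‖φ‖₆³ ‖B‖₂)^{3/2}; dividing by ‖φ‖₆^{9/2} leaves ‖φ‖₆ ≤
‖B‖₂. -/
theorem SmoothFn.eLpNorm_six_le {φ : Torus → ℝ} (h : SmoothFn φ) :
    eLpNorm φ 6 volume ≤ ENNReal.ofReal (sobNorm (toL2 φ)) := by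
  set A := ∫⁻ x, ‖φ x‖ₑ ^ 6 with hA
  have hA6 : A = eLpNorm φ 6 volume ^ 6 := by
    have := lintegral_enorm_pow (volume : Measure Torus) φ (k := 6) (by norm_num)
    exact_mod_cast this
  let B : Torus → ℝ := fun x => |φ x| + 4 * ∑ j, |CrankNicolsonNSE.partialDeriv j φ x|
  have hBc : Continuous B := by
    have := h.continuous
    have h2 := fun j => (h.partialDeriv j).continuous
    fun_prop
  have hBm : Measurable fun x => ‖B x‖ₑ := hBc.measurable.enorm
  have hφm : Measurable fun x => ‖φ x‖ₑ := h.continuous.measurable.enorm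
  have h1 := (h.pow 4).lintegral_rpow_le
  have e1 : ∀ x, ‖φ x ^ 4‖ₑ ^ (3 / 2 : ℝ) = ‖φ x‖ₑ ^ 6 := by
    intro x
    rw [enorm_pow, ← ENNReal.rpow_natCast, ← ENNReal.rpow_natCast, ← ENNReal.rpow_mul]
    norm_num
  have e2 : ∀ x, ‖φ x ^ 4‖ₑ + ∑ j, ‖CrankNicolsonNSE.partialDeriv j (fun x => φ x ^ 4) x‖ₑ
      = ‖φ x‖ₑ ^ 3 * ‖B x‖ₑ := by
    intro x
    have hB : ‖B x‖ₑ = ‖φ x‖ₑ + 4 * ∑ j, ‖CrankNicolsonNSE.partialDeriv j φ x‖ₑ := by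
      have h0 : 0 ≤ B x := by positivity
      rw [Real.enorm_of_nonneg h0, ENNReal.ofReal_add (by positivity) (by positivity),
        ENNReal.ofReal_mul (by norm_num), ENNReal.ofReal_sum_of_nonneg (fun _ _ => abs_nonneg _)]
      simp [Real.enorm_eq_ofReal_abs]
    rw [hB]
    simp_rw [h.partialDeriv_pow, enorm_mul, enorm_pow]
    rw [← Finset.mul_sum]
    have : ‖((4 : ℕ) : ℝ)‖ₑ = 4 := by
      rw [Real.enorm_of_nonneg (by norm_num)]; norm_num
    rw [this]
    ring
  simp_rw [e1, e2] at h1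
  have h2 := ENNReal.lintegral_mul_le_Lp_mul_Lq (volume : Measure Torus)
    Real.HolderConjugate.two_two (hφm.pow_const 3).aemeasurable hBm.aemeasurable
  simp only [Pi.mul_apply] at h2
  have e3 : ∫⁻ x, (‖φ x‖ₑ ^ 3) ^ (2 : ℝ) = A := by
    refine lintegral_congr fun x => ?_
    rw [← ENNReal.rpow_natCast, ← ENNReal.rpow_natCast, ← ENNReal.rpow_mul]
    norm_num
  rw [e3] at h2
  have e4 : (∫⁻ x, ‖B x‖ₑ ^ (2 : ℝ)) ^ (1 / 2 : ℝ) = eLpNorm B 2 volume := by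
    rw [eLpNorm_eq_lintegral_rpow_enorm_toReal (by norm_num) (by norm_num)]
    norm_num
  rw [e4] at h2
  have h3 : A ≤ (A ^ (1 / 2 : ℝ) * eLpNorm B 2 volume) ^ (3 / 2 : ℝ) :=
    h1.trans (ENNReal.rpow_le_rpow h2 (by norm_num))
  have h4 : eLpNorm φ 6 volume ≤ eLpNorm B 2 volume := by
    set a := eLpNorm φ 6 volume
    by_cases ha : a = 0
    · rw [ha]; exact zero_le
    have hat : a ≠ ⊤ := (h.memLp 6).2.ne
    rw [hA6, ENNReal.mul_rpow_of_nonneg _ _ (by norm_num), ← ENNReal.rpow_natCast,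
      ← ENNReal.rpow_mul, ← ENNReal.rpow_mul] at h3
    norm_num at h3
    have h5 : a ^ (6 : ℝ) = a ^ (9 / 2 : ℝ) * a ^ (3 / 2 : ℝ) := by
      rw [← ENNReal.rpow_add _ _ ha hat]; norm_num
    have h3' : a ^ (6 : ℝ) ≤ a ^ (9 / 2 : ℝ) * eLpNorm B 2 volume ^ (3 / 2 : ℝ) := by
      exact_mod_cast h3
    rw [h5, ENNReal.mul_le_mul_iff_right (ENNReal.rpow_pos (pos_iff_ne_zero.2 ha) hat).ne'
      (ENNReal.rpow_ne_top_of_nonneg (by norm_num) hat)] at h3'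
    exact (ENNReal.rpow_le_rpow_iff (by norm_num)).1 h3'
  refine h4.trans ?_
  have habs : ∀ {ψ : Torus → ℝ}, SmoothFn ψ →
      eLpNorm (fun x => |ψ x|) 2 volume = ENNReal.ofReal ‖toL2 ψ‖ := by
    intro ψ hψ
    rw [← eLpNorm_toL2 (hψ.memLp 2)]
    exact eLpNorm_norm ψ
  have hms : ∀ {ψ : Torus → ℝ}, SmoothFn ψ →
      AEStronglyMeasurable (fun x => |ψ x|) (volume : Measure Torus) := fun hψ =>
    hψ.continuous.abs.aestronglyMeasurable
  have hs : (fun x => ∑ j, |CrankNicolsonNSE.partialDeriv j φ x|)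
      = ∑ j, fun x => |CrankNicolsonNSE.partialDeriv j φ x| := by
    ext x; simp
  have hsm : AEStronglyMeasurable (fun x => ∑ j, |CrankNicolsonNSE.partialDeriv j φ x|)
      (volume : Measure Torus) := by
    rw [hs]; exact Finset.aestronglyMeasurable_sum _ fun j _ => hms (h.partialDeriv j)
  have hw : ∀ j, weakDeriv j (toL2 φ) = toL2 (CrankNicolsonNSE.partialDeriv j φ) := fun j =>
    (h.hasWeakDeriv j).weakDeriv_eq
  calc eLpNorm B 2 volume
      ≤ eLpNorm (fun x => |φ x|) 2 volume
        + eLpNorm (fun x => 4 * ∑ j, |CrankNicolsonNSE.partialDeriv j φ x|) 2 volume :=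
        eLpNorm_add_le (hms h) (hsm.const_mul 4) (by norm_num)
    _ ≤ ENNReal.ofReal ‖toL2 φ‖
        + 4 * ∑ j, ENNReal.ofReal ‖toL2 (CrankNicolsonNSE.partialDeriv j φ)‖ := by
        rw [habs h]
        refine add_le_add le_rfl ?_
        have h6 := eLpNorm_const_smul (4 : ℝ)
          (fun x => ∑ j, |CrankNicolsonNSE.partialDeriv j φ x|) 2 (volume : Measure Torus)
        have h7 : ‖(4 : ℝ)‖ₑ = 4 := by
          rw [Real.enorm_of_nonneg (by norm_num)]; norm_num
        rw [h7] at h6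
        refine (le_of_eq h6).trans (mul_le_mul_right ?_ 4)
        rw [hs]
        refine (eLpNorm_sum_le (fun j _ => hms (h.partialDeriv j)) (by norm_num)).trans ?_
        exact le_of_eq (Finset.sum_congr rfl fun j _ => habs (h.partialDeriv j))
    _ = ENNReal.ofReal (sobNorm (toL2 φ)) := by
        rw [sobNorm, ENNReal.ofReal_add (by positivity) (by positivity),
          ENNReal.ofReal_mul (by norm_num), ENNReal.ofReal_sum_of_nonneg (fun _ _ => norm_nonneg _)]
        simp [hw]

/-- Smooth approximations converge almost everywhere along a subsequence, and by Fatou the L⁶ norm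
is lower semicontinuous. -/
theorem MemH1.eLpNorm_six_le {f : L2} (hf : MemH1 f) :
    eLpNorm f 6 volume ≤ ENNReal.ofReal (sobNorm f) := by
  obtain ⟨φ, h1, h2, h3⟩ := hf.exists_smooth
  obtain ⟨ns, hns, hae⟩ := (tendstoInMeasure_of_tendsto_Lp h2).exists_seq_tendsto_ae
  have hlim : Tendsto (fun k => ENNReal.ofReal (sobNorm (toL2 (φ (ns k))))) atTop
      (𝓝 (ENNReal.ofReal (sobNorm f))) := by
    refine (ENNReal.continuous_ofReal.tendsto _).comp ?_
    have : Tendsto (fun k => ‖toL2 (φ k)‖ + 4 * ∑ j, ‖toL2 (partialDeriv j (φ k))‖) atTop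
        (𝓝 (‖f‖ + 4 * ∑ j, ‖weakDeriv j f‖)) :=
      h2.norm.add ((tendsto_finsetSum _ fun j _ => (h3 j).norm).const_mul 4)
    refine (this.comp hns.tendsto_atTop).congr fun k => ?_
    simp only [Function.comp, sobNorm, ((h1 (ns k)).hasWeakDeriv _).weakDeriv_eq]
  refine (Lp.eLpNorm_lim_le_liminf_eLpNorm (fun k => Lp.aestronglyMeasurable _) _ hae).trans ?_
  rw [← hlim.liminf_eq]
  refine liminf_le_liminf (Eventually.of_forall fun k => ?_)
  rw [eLpNorm_congr_ae (toL2_coe ((h1 (ns k)).memLp 2))]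
  exact (h1 (ns k)).eLpNorm_six_le

/-! ## Trilinear estimates -/

theorem lintegral_enorm_sq (f : L2) : ∫⁻ x, ‖f x‖ₑ ^ 2 = ENNReal.ofReal ‖f‖ ^ 2 := by
  have := lintegral_enorm_pow (volume : Measure Torus) f (k := 2) (by norm_num)
  rw [this, Lp.norm_def, ENNReal.ofReal_toReal (Lp.eLpNorm_ne_top _)]
  norm_cast

theorem MemH1.lintegral_enorm_pow_six_le {f : L2} (hf : MemH1 f) :
    ∫⁻ x, ‖f x‖ₑ ^ 6 ≤ ENNReal.ofReal (sobNorm f) ^ 6 := by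
  have := lintegral_enorm_pow (volume : Measure Torus) f (k := 6) (by norm_num)
  rw [this]
  exact pow_le_pow_left' (by exact_mod_cast hf.eLpNorm_six_le) 6

theorem pow_rpow_eq_rpow_mul (a : ℝ≥0∞) (k : ℕ) (p : ℝ) : (a ^ k) ^ p = a ^ (k * p) := by
  rw [← ENNReal.rpow_natCast, ← ENNReal.rpow_mul]

/-- Hölder with `a` in L³, `b` in L⁶ and `g` in L². The L³ norm is interpolated in the same step by
splitting |a| into (|a|²)^{1/4} (|a|⁶)^{1/12}, so the weights are 1/4, 1/12, 1/6, 1/2 with sum 1. -/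
theorem lintegral_mul_mul_le {a b : L2} (ha : MemH1 a) (hb : MemH1 b) (g : L2) :
    ∫⁻ x, ‖a x‖ₑ * ‖b x‖ₑ * ‖g x‖ₑ
      ≤ ENNReal.ofReal (√‖a‖ * √(sobNorm a) * sobNorm b * ‖g‖) := by
  have hm : ∀ f : L2, AEMeasurable (fun x => ‖f x‖ₑ) volume := fun f =>
    (Lp.aestronglyMeasurable f).enorm
  have h := ENNReal.lintegral_prod_norm_pow_le (μ := (volume : Measure Torus)) Finset.univ
    (f := ![fun x => ‖a x‖ₑ ^ 2, fun x => ‖a x‖ₑ ^ 6, fun x => ‖b x‖ₑ ^ 6, fun x => ‖g x‖ₑ ^ 2])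
    (p := ![1 / 4, 1 / 12, 1 / 6, 1 / 2])
    (by
      intro i _
      fin_cases i
      · exact (hm a).pow_const 2
      · exact (hm a).pow_const 6
      · exact (hm b).pow_const 6
      · exact (hm g).pow_const 2)
    (by simp [Fin.sum_univ_four]; norm_num)
    (by intro i _; fin_cases i <;> simp)
  simp only [Fin.prod_univ_four] at h
  simp only [Matrix.cons_val] at h
  have e : ∀ x, ‖a x‖ₑ * ‖b x‖ₑ * ‖g x‖ₑ = (‖a x‖ₑ ^ 2) ^ (1 / 4 : ℝ) * (‖a x‖ₑ ^ 6) ^ (1 / 12 : ℝ)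
      * (‖b x‖ₑ ^ 6) ^ (1 / 6 : ℝ) * (‖g x‖ₑ ^ 2) ^ (1 / 2 : ℝ) := by
    intro x
    simp only [pow_rpow_eq_rpow_mul]
    rw [← ENNReal.rpow_add_of_nonneg _ _ (by norm_num) (by norm_num)]
    norm_num
  simp_rw [e]
  refine h.trans ?_
  have hs : ∀ r : ℝ, 0 ≤ r → ENNReal.ofReal (√r) = ENNReal.ofReal r ^ (1 / 2 : ℝ) := fun r hr => by
    rw [Real.sqrt_eq_rpow, ENNReal.ofReal_rpow_of_nonneg hr (by norm_num)]
  have hsa := sobNorm_nonneg a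
  have hsb := sobNorm_nonneg b
  rw [ENNReal.ofReal_mul (by positivity), ENNReal.ofReal_mul (by positivity),
    ENNReal.ofReal_mul (by positivity), hs _ (norm_nonneg a), hs _ hsa]
  gcongr ?_ * ?_ * ?_ * ?_
  · rw [lintegral_enorm_sq, pow_rpow_eq_rpow_mul]; norm_num
  · refine (ENNReal.rpow_le_rpow ha.lintegral_enorm_pow_six_le (by norm_num)).trans ?_
    rw [pow_rpow_eq_rpow_mul]; norm_num
  · refine (ENNReal.rpow_le_rpow hb.lintegral_enorm_pow_six_le (by norm_num)).trans ?_
    rw [pow_rpow_eq_rpow_mul]; norm_num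
  · rw [lintegral_enorm_sq, pow_rpow_eq_rpow_mul]; norm_num

/-- Cauchy–Schwarz for |f| · |f|³. It serves the Bernoulli term, where |u|² must be estimated in L².
-/
theorem MemH1.lintegral_enorm_pow_four_le {f : L2} (hf : MemH1 f) :
    ∫⁻ x, ‖f x‖ₑ ^ 4 ≤ ENNReal.ofReal (‖f‖ * sobNorm f ^ 3) := by
  have hm : AEMeasurable (fun x => ‖f x‖ₑ) volume := (Lp.aestronglyMeasurable f).enorm
  have h := ENNReal.lintegral_mul_norm_pow_le (μ := (volume : Measure Torus))
    (hm.pow_const 2) (hm.pow_const 6) (p := 1 / 2) (q := 1 / 2)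
    (by norm_num) (by norm_num) (by norm_num)
  have e : ∀ x, ‖f x‖ₑ ^ 4 = (‖f x‖ₑ ^ 2) ^ (1 / 2 : ℝ) * (‖f x‖ₑ ^ 6) ^ (1 / 2 : ℝ) := by
    intro x
    simp only [pow_rpow_eq_rpow_mul]
    rw [← ENNReal.rpow_add_of_nonneg _ _ (by norm_num) (by norm_num), ← ENNReal.rpow_natCast]
    norm_num
  simp_rw [e]
  refine h.trans ?_
  rw [ENNReal.ofReal_mul (norm_nonneg _), ENNReal.ofReal_pow (sobNorm_nonneg f)]
  gcongr
  · rw [lintegral_enorm_sq, pow_rpow_eq_rpow_mul]; norm_num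
  · refine (ENNReal.rpow_le_rpow hf.lintegral_enorm_pow_six_le (by norm_num)).trans ?_
    rw [pow_rpow_eq_rpow_mul, ← ENNReal.rpow_natCast]; norm_num


/-- The integral `∫ a b g`. -/
def triple (a b g : L2) : ℝ := ∫ x, a x * b x * g x

theorem integrable_triple {a b : L2} (ha : MemH1 a) (hb : MemH1 b) (g : L2) :
    Integrable (fun x => a x * b x * g x) := by
  refine ⟨((Lp.aestronglyMeasurable a).mul (Lp.aestronglyMeasurable b)).mul
    (Lp.aestronglyMeasurable g), ?_⟩
  rw [hasFiniteIntegral_iff_enorm]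
  simp_rw [enorm_mul]
  exact (lintegral_mul_mul_le ha hb g).trans_lt ENNReal.ofReal_lt_top

theorem abs_triple_le {a b : L2} (ha : MemH1 a) (hb : MemH1 b) (g : L2) :
    |triple a b g| ≤ √‖a‖ * √(sobNorm a) * sobNorm b * ‖g‖ := by
  have hsb := sobNorm_nonneg b
  have h1 := enorm_integral_le_lintegral_enorm (μ := volume) (fun x => a x * b x * g x)
  simp_rw [enorm_mul] at h1
  have h2 := h1.trans (lintegral_mul_mul_le ha hb g)
  rw [Real.enorm_eq_ofReal_abs] at h2
  exact (ENNReal.ofReal_le_ofReal_iff (by positivity)).1 h2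

theorem norm_le_sobNorm (a : L2) : ‖a‖ ≤ sobNorm a := by
  unfold sobNorm
  have : 0 ≤ ∑ j, ‖weakDeriv j a‖ := by positivity
  linarith

/-- A cruder bound, used only for continuity of `triple` in density arguments. -/
theorem abs_triple_le' {a b : L2} (ha : MemH1 a) (hb : MemH1 b) (g : L2) :
    |triple a b g| ≤ sobNorm a * sobNorm b * ‖g‖ := by
  refine (abs_triple_le ha hb g).trans ?_
  have := Real.sqrt_le_sqrt (norm_le_sobNorm a)
  have hsa := sobNorm_nonneg a
  have hsb := sobNorm_nonneg b
  gcongr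
  calc √‖a‖ * √(sobNorm a) ≤ √(sobNorm a) * √(sobNorm a) := by gcongr
    _ = sobNorm a := Real.mul_self_sqrt hsa

theorem triple_comm (a b g : L2) : triple a b g = triple b a g := by
  simp only [triple, mul_comm]

theorem triple_sub_left {a a' b : L2} (ha : MemH1 a) (ha' : MemH1 a') (hb : MemH1 b) (g : L2) :
    triple (a - a') b g = triple a b g - triple a' b g := by
  rw [triple, triple, triple, ← integral_sub (integrable_triple ha hb g)
    (integrable_triple ha' hb g)]
  apply integral_congr_ae
  filter_upwards [Lp.coeFn_sub a a'] with x hx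
  rw [hx, Pi.sub_apply]; ring

theorem triple_add_right {a b : L2} (ha : MemH1 a) (hb : MemH1 b) (g g' : L2) :
    triple a b (g + g') = triple a b g + triple a b g' := by
  rw [triple, triple, triple, ← integral_add (integrable_triple ha hb g)
    (integrable_triple ha hb g')]
  apply integral_congr_ae
  filter_upwards [Lp.coeFn_add g g'] with x hx
  rw [hx, Pi.add_apply]; ring

theorem triple_sub_right {a b : L2} (ha : MemH1 a) (hb : MemH1 b) (g g' : L2) :
    triple a b (g - g') = triple a b g - triple a b g' := by
  have := triple_add_right ha hb (g - g') g'
  rw [sub_add_cancel] at this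
  linarith

theorem tendsto_triple_left {a : ℕ → L2} {a₀ b : L2} (ha : ∀ k, MemH1 (a k)) (ha₀ : MemH1 a₀)
    (hb : MemH1 b) (h : Tendsto (fun k => sobNorm (a k - a₀)) atTop (𝓝 0)) (g : L2) :
    Tendsto (fun k => triple (a k) b g) atTop (𝓝 (triple a₀ b g)) := by
  rw [tendsto_iff_norm_sub_tendsto_zero]
  refine squeeze_zero (fun _ => norm_nonneg _) (fun k => ?_)
    (g := fun k => sobNorm (a k - a₀) * (sobNorm b * ‖g‖)) (by simpa using h.mul_const _)
  rw [← triple_sub_left (ha k) ha₀ hb, ← mul_assoc]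
  exact abs_triple_le' ((ha k).sub ha₀) hb g

theorem tendsto_triple_right {a b : L2} (ha : MemH1 a) (hb : MemH1 b) {g : ℕ → L2} {g₀ : L2}
    (h : Tendsto g atTop (𝓝 g₀)) :
    Tendsto (fun k => triple a b (g k)) atTop (𝓝 (triple a b g₀)) := by
  rw [tendsto_iff_norm_sub_tendsto_zero] at h ⊢
  refine squeeze_zero (fun _ => norm_nonneg _) (fun k => ?_)
    (g := fun k => sobNorm a * sobNorm b * ‖g k - g₀‖) (by simpa using h.const_mul _)
  rw [← triple_sub_right ha hb]
  exact abs_triple_le' ha hb _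

theorem SmoothFn.memH1 {φ : Torus → ℝ} (h : SmoothFn φ) : MemH1 (toL2 φ) :=
  fun j => ⟨_, h.hasWeakDeriv j⟩

theorem SmoothFn.weakDeriv_toL2 {φ : Torus → ℝ} (h : SmoothFn φ) (j : Fin 3) :
    weakDeriv j (toL2 φ) = toL2 (CrankNicolsonNSE.partialDeriv j φ) :=
  (h.hasWeakDeriv j).weakDeriv_eq

theorem MemH1.exists_smooth_sobNorm {f : L2} (hf : MemH1 f) : ∃ φ : ℕ → Torus → ℝ,
    (∀ k, SmoothFn (φ k)) ∧ Tendsto (fun k => sobNorm (toL2 (φ k) - f)) atTop (𝓝 0) ∧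
    ∀ j, Tendsto (fun k => weakDeriv j (toL2 (φ k))) atTop (𝓝 (weakDeriv j f)) := by
  obtain ⟨φ, h1, h2, h3⟩ := hf.exists_smooth
  have h4 : ∀ j, Tendsto (fun k => weakDeriv j (toL2 (φ k))) atTop (𝓝 (weakDeriv j f)) :=
    fun j => (h3 j).congr fun k => ((h1 k).weakDeriv_toL2 j).symm
  refine ⟨φ, h1, ?_, h4⟩
  simp only [sobNorm, fun k j => weakDeriv_sub (h1 k).memH1 hf j]
  have := (tendsto_iff_norm_sub_tendsto_zero.1 h2).add
    ((tendsto_finsetSum Finset.univ fun j _ =>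
      tendsto_iff_norm_sub_tendsto_zero.1 (h4 j)).const_mul 4)
  simpa using this

/-- Integration by parts for products of three functions in `H¹`. -/
theorem triple_weakDeriv {a b c : L2} (ha : MemH1 a) (hb : MemH1 b) (hc : MemH1 c) (j : Fin 3) :
    triple b c (weakDeriv j a) + triple a c (weakDeriv j b) + triple a b (weakDeriv j c) = 0 := by
  -- With two smooth factors this is the definition of the weak derivative of `a`, tested with βγ.
  -- The factors `b` and `c` are then reached one at a time by density.
  have smooth_smooth : ∀ {β γ : Torus → ℝ}, SmoothFn β → SmoothFn γ →
      triple (toL2 β) (toL2 γ) (weakDeriv j a) + triple a (toL2 γ) (weakDeriv j (toL2 β))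
        + triple a (toL2 β) (weakDeriv j (toL2 γ)) = 0 := by
    intro β γ hβ hγ
    have h := ha.hasWeakDeriv j (fun x => β x * γ x) (hβ.mul hγ)
    have hae : ∀ᵐ x, toL2 β x = β x ∧ toL2 γ x = γ x
        ∧ weakDeriv j (toL2 β) x = partialDeriv j β x
        ∧ weakDeriv j (toL2 γ) x = partialDeriv j γ x := by
      rw [hβ.weakDeriv_toL2, hγ.weakDeriv_toL2]
      filter_upwards [toL2_coe (hβ.memLp 2), toL2_coe (hγ.memLp 2),
        toL2_coe ((hβ.partialDeriv j).memLp 2), toL2_coe ((hγ.partialDeriv j).memLp 2)]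
        with x h1 h2 h3 h4
      exact ⟨h1, h2, h3, h4⟩
    have e1 : triple (toL2 β) (toL2 γ) (weakDeriv j a)
        = ∫ x, weakDeriv j a x * (β x * γ x) := by
      refine integral_congr_ae ?_
      filter_upwards [hae] with x ⟨h1, h2, _, _⟩
      rw [h1, h2]; ring
    have e2 : triple a (toL2 γ) (weakDeriv j (toL2 β)) + triple a (toL2 β) (weakDeriv j (toL2 γ))
        = ∫ x, a x * partialDeriv j (fun x => β x * γ x) x := by
      rw [triple, triple, ← integral_add (integrable_triple ha hγ.memH1 _)
        (integrable_triple ha hβ.memH1 _)]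
      refine integral_congr_ae ?_
      filter_upwards [hae] with x ⟨h1, h2, h3, h4⟩
      rw [h1, h2, h3, h4, hβ.partialDeriv_mul hγ]; ring
    rw [add_assoc, e2, e1, h]; ring
  have smooth : ∀ {γ : Torus → ℝ}, SmoothFn γ →
      triple b (toL2 γ) (weakDeriv j a) + triple a (toL2 γ) (weakDeriv j b)
        + triple a b (weakDeriv j (toL2 γ)) = 0 := by
    intro γ hγ
    obtain ⟨φ, h1, h2, h3⟩ := hb.exists_smooth_sobNorm
    have l1 := tendsto_triple_left (fun k => (h1 k).memH1) hb hγ.memH1 h2 (weakDeriv j a)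
    have l2 := tendsto_triple_right ha hγ.memH1 (h3 j)
    have l3 := tendsto_triple_left (fun k => (h1 k).memH1) hb ha h2 (weakDeriv j (toL2 γ))
    simp_rw [triple_comm _ a] at l3
    refine tendsto_nhds_unique ((l1.add l2).add l3) ?_
    simp_rw [smooth_smooth (h1 _) hγ]
    exact tendsto_const_nhds
  obtain ⟨φ, h1, h2, h3⟩ := hc.exists_smooth_sobNorm
  have l1 := tendsto_triple_left (fun k => (h1 k).memH1) hc hb h2 (weakDeriv j a)
  have l2 := tendsto_triple_left (fun k => (h1 k).memH1) hc ha h2 (weakDeriv j b)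
  have l3 := tendsto_triple_right ha hb (h3 j)
  simp_rw [triple_comm _ b] at l1
  simp_rw [triple_comm _ a] at l2
  refine tendsto_nhds_unique ((l1.add l2).add l3) ?_
  simp_rw [smooth (h1 _)]
  exact tendsto_const_nhds

/-! ## Vector fields -/

theorem divg_add {u v : VecL2} (hu : MemH1Vec u) (hv : MemH1Vec v) :
    divg (u + v) = divg u + divg v := by
  simp only [divg, PiLp.add_apply, fun i => weakDeriv_add (hu i) (hv i), Finset.sum_add_distrib]

theorem divg_smul {u : VecL2} (c : ℝ) (hu : MemH1Vec u) :
    divg (c • u) = c • divg u := by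
  simp only [divg, PiLp.smul_apply, fun i => weakDeriv_smul (hu i), Finset.smul_sum]

theorem inner_grad_eq_neg {q : L2} {w : VecL2} (hq : MemH1 q) (hw : MemH1Vec w) :
    inner ℝ (grad q) w = - inner ℝ q (divg w) := by
  rw [inner_grad, divg, inner_sum, ← Finset.sum_neg_distrib]
  exact Finset.sum_congr rfl fun i _ => inner_weakDeriv hq (hw i) i

theorem h1Norm_nonneg (u : VecL2) : 0 ≤ h1Norm u := Real.sqrt_nonneg _

theorem h1Norm_sq (u : VecL2) : h1Norm u ^ 2 = ‖u‖ ^ 2 + ∑ i, ‖grad (u i)‖ ^ 2 :=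
  Real.sq_sqrt (by positivity)

theorem norm_le_h1Norm (u : VecL2) : ‖u‖ ≤ h1Norm u := by
  refine Real.le_sqrt_of_sq_le ?_
  have : 0 ≤ ∑ i, ‖grad (u i)‖ ^ 2 := by positivity
  linarith

theorem norm_apply_le_norm (u : VecL2) (i : Fin 3) : ‖u i‖ ≤ ‖u‖ := PiLp.norm_apply_le u i

theorem norm_weakDeriv_le_norm_grad (q : L2) (j : Fin 3) : ‖weakDeriv j q‖ ≤ ‖grad q‖ :=
  PiLp.norm_apply_le (grad q) j

theorem norm_weakDeriv_le_h1Norm (u : VecL2) (i j : Fin 3) :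
    ‖weakDeriv j (u i)‖ ≤ h1Norm u := by
  refine (norm_weakDeriv_le_norm_grad (u i) j).trans (Real.le_sqrt_of_sq_le ?_)
  have := Finset.single_le_sum (f := fun i => ‖grad (u i)‖ ^ 2) (fun i _ => by positivity)
    (Finset.mem_univ i)
  have h2 := sq_nonneg ‖u‖
  simp only at this
  linarith

theorem sobNorm_le_h1Norm (u : VecL2) (i : Fin 3) : sobNorm (u i) ≤ 13 * h1Norm u := by
  have h1 := (norm_apply_le_norm u i).trans (norm_le_h1Norm u)
  have h2 := norm_weakDeriv_le_h1Norm u i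
  -- 13 = 1 + 4 · 3.
  rw [sobNorm, Fin.sum_univ_three]
  linarith [h2 0, h2 1, h2 2]

theorem norm_divg_le (u : VecL2) : ‖divg u‖ ≤ 3 * h1Norm u := by
  refine (norm_sum_le _ _).trans ?_
  rw [Fin.sum_univ_three]
  linarith [norm_weakDeriv_le_h1Norm u 0 0, norm_weakDeriv_le_h1Norm u 1 1,
    norm_weakDeriv_le_h1Norm u 2 2]

theorem norm_curl_le (u : VecL2) (k : Fin 3) : ‖curl u k‖ ≤ 2 * h1Norm u := by
  have h := norm_weakDeriv_le_h1Norm u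
  fin_cases k
  · refine (norm_sub_le (weakDeriv 1 (u 2)) (weakDeriv 2 (u 1))).trans ?_
    linarith [h 2 1, h 1 2]
  · refine (norm_sub_le (weakDeriv 2 (u 0)) (weakDeriv 0 (u 2))).trans ?_
    linarith [h 0 2, h 2 0]
  · refine (norm_sub_le (weakDeriv 0 (u 1)) (weakDeriv 1 (u 0))).trans ?_
    linarith [h 1 0, h 0 1]

theorem gradInner_self (u : VecL2) : gradInner u u = ∑ i, ‖grad (u i)‖ ^ 2 := by
  simp [gradInner]

theorem abs_gradInner_le (u v : VecL2) : |gradInner u v| ≤ 3 * (h1Norm u * h1Norm v) := by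
  have hb : ∀ (w : VecL2) i, ‖grad (w i)‖ ≤ h1Norm w := by
    intro w i
    refine Real.le_sqrt_of_sq_le ?_
    have := Finset.single_le_sum (f := fun i => ‖grad (w i)‖ ^ 2) (fun i _ => by positivity)
      (Finset.mem_univ i)
    have h2 := sq_nonneg ‖w‖
    simp only at this
    linarith
  have h : ∀ i, |inner ℝ (grad (u i)) (grad (v i))| ≤ h1Norm u * h1Norm v := fun i =>
    (abs_real_inner_le_norm _ _).trans
      (mul_le_mul (hb u i) (hb v i) (norm_nonneg _) (h1Norm_nonneg u))
  refine (Finset.abs_sum_le_sum_abs _ _).trans ?_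
  rw [Fin.sum_univ_three]
  linarith [h 0, h 1, h 2]

/-! ## The convective forms -/

/-- The quantity `13 ‖u‖₂^{1/2} (13 ‖u‖_{H¹})^{1/2} ‖u‖_{H¹} ‖w‖_{H¹}` controlling
the convective forms. -/
def convBound (u w : VecL2) : ℝ :=
  √‖u‖ * √(13 * h1Norm u) * (13 * h1Norm w) * h1Norm u

theorem convBound_nonneg (u w : VecL2) : 0 ≤ convBound u w := by
  have := h1Norm_nonneg u
  have := h1Norm_nonneg w
  unfold convBound; positivity

theorem abs_triple_le_convBound {u w : VecL2} (hu : MemH1Vec u) (hw : MemH1Vec w) (i j : Fin 3)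
    {g : L2} {c : ℝ} (hg : ‖g‖ ≤ c * h1Norm u) :
    |triple (u i) (w j) g| ≤ c * convBound u w := by
  refine (abs_triple_le (hu i) (hw j) g).trans ?_
  have hsw := sobNorm_nonneg (w j)
  have h1 := h1Norm_nonneg u
  have h2 := h1Norm_nonneg w
  calc √‖u i‖ * √(sobNorm (u i)) * sobNorm (w j) * ‖g‖
      ≤ √‖u‖ * √(13 * h1Norm u) * (13 * h1Norm w) * (c * h1Norm u) := by
        gcongr
        · exact norm_apply_le_norm u i
        · exact sobNorm_le_h1Norm u i
        · exact sobNorm_le_h1Norm w j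
    _ = c * convBound u w := by rw [convBound]; ring

/-- The scalar triple product is expanded with the curl in the last slot of `triple`, the only one
that asks for no more than L². For w = v the six terms cancel in pairs. -/
theorem rotForm_eq {u v w : VecL2} (hv : MemH1Vec v) (hw : MemH1Vec w) :
    rotForm u v w = (triple (v 2) (w 0) (curl u 1) - triple (v 1) (w 0) (curl u 2))
      + (triple (v 0) (w 1) (curl u 2) - triple (v 2) (w 1) (curl u 0))
      + (triple (v 1) (w 2) (curl u 0) - triple (v 0) (w 2) (curl u 1)) := by
  have hI := fun i j k => integrable_triple (hv i) (hw j) (curl u k)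
  have hS : ∀ i j k i' j' k', Integrable (fun x => v i x * w j x * curl u k x
      - v i' x * w j' x * curl u k' x) := fun i j k i' j' k' => (hI i j k).sub (hI i' j' k')
  simp only [triple]
  rw [← integral_sub (hI 2 0 1) (hI 1 0 2), ← integral_sub (hI 0 1 2) (hI 2 1 0),
    ← integral_sub (hI 1 2 0) (hI 0 2 1), ← integral_add (hS 2 0 1 1 0 2) (hS 0 1 2 2 1 0),
    ← integral_add ((hS 2 0 1 1 0 2).fun_add (hS 0 1 2 2 1 0)) (hS 1 2 0 0 2 1), rotForm]
  refine integral_congr_ae (Eventually.of_forall fun x => ?_)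
  simp [cross_apply, dotProduct, Fin.sum_univ_three]
  ring

theorem rotForm_self {u : VecL2} (hu : MemH1Vec u) : rotForm u u u = 0 := by
  rw [rotForm_eq hu hu, triple_comm (u 2) (u 0), triple_comm (u 2) (u 1), triple_comm (u 1) (u 0)]
  ring

theorem abs_rotForm_le {u w : VecL2} (hu : MemH1Vec u) (hw : MemH1Vec w) :
    |rotForm u u w| ≤ 12 * convBound u w := by
  have h : ∀ i j k, |triple (u i) (w j) (curl u k)| ≤ 2 * convBound u w := fun i j k =>
    abs_triple_le_convBound hu hw i j (norm_curl_le u k)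
  rw [rotForm_eq hu hw, abs_le]
  constructor <;>
  linarith [abs_le.1 (h 2 0 1), abs_le.1 (h 1 0 2), abs_le.1 (h 0 1 2), abs_le.1 (h 2 1 0),
    abs_le.1 (h 1 2 0), abs_le.1 (h 0 2 1)]

theorem trilinear_symmetrized_eq (D : DiscretePair) {u w : VecL2} (hu : MemH1Vec u)
    (hw : MemH1Vec w) : trilinear D .symmetrized u u w
      = (∑ i, ∑ j, triple (u j) (w i) (weakDeriv j (u i)))
        + (1 / 2) * ∑ i, triple (u i) (w i) (divg u) := by
  have h1 := fun i j => integrable_triple (hu j) (hw i) (weakDeriv j (u i))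
  have h2 := fun i => integrable_triple (hu i) (hw i) (divg u)
  simp only [triple]
  simp_rw [← integral_finsetSum Finset.univ (fun j _ => h1 _ j)]
  rw [← integral_finsetSum Finset.univ
      (fun i _ => integrable_finsetSum Finset.univ (fun j _ => h1 i j)),
    ← integral_finsetSum Finset.univ (fun i _ => h2 i), ← integral_const_mul,
    ← integral_add (integrable_finsetSum Finset.univ
      (fun i _ => integrable_finsetSum Finset.univ (fun j _ => h1 i j)))
      ((integrable_finsetSum Finset.univ (fun i _ => h2 i)).const_mul _), trilinear]
  refine integral_congr_ae (Eventually.of_forall fun x => ?_)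
  simp only [mul_right_comm]

theorem trilinear_symmetrized_self (D : DiscretePair) {u : VecL2} (hu : MemH1Vec u) :
    trilinear D .symmetrized u u u = 0 := by
  rw [trilinear_symmetrized_eq D hu hu, Finset.mul_sum, ← Finset.sum_add_distrib]
  refine Finset.sum_eq_zero fun i _ => ?_
  have hd : triple (u i) (u i) (divg u) = ∑ j, triple (u i) (u i) (weakDeriv j (u j)) := by
    rw [divg, Fin.sum_univ_three, Fin.sum_univ_three, triple_add_right (hu i) (hu i),
      triple_add_right (hu i) (hu i)]
  rw [hd, Finset.mul_sum, ← Finset.sum_add_distrib]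
  refine Finset.sum_eq_zero fun j _ => ?_
  -- This says 2∫ uⱼ uᵢ ∂ⱼuᵢ + ∫ uᵢ² ∂ⱼuⱼ = 0, so the factor ½ before the divergence gives exact
  -- cancellation, without any condition on div u.
  have := triple_weakDeriv (hu j) (hu i) (hu i) j
  linarith

theorem abs_trilinear_symmetrized_le (D : DiscretePair) {u w : VecL2} (hu : MemH1Vec u)
    (hw : MemH1Vec w) : |trilinear D .symmetrized u u w| ≤ 14 * convBound u w := by
  have h1 : ∀ i j, |triple (u j) (w i) (weakDeriv j (u i))| ≤ 1 * convBound u w := fun i j =>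
    abs_triple_le_convBound hu hw j i (by rw [one_mul]; exact norm_weakDeriv_le_h1Norm u i j)
  have h2 : ∀ i, |triple (u i) (w i) (divg u)| ≤ 3 * convBound u w := fun i =>
    abs_triple_le_convBound hu hw i i (norm_divg_le u)
  have h3 : |∑ i, ∑ j, triple (u j) (w i) (weakDeriv j (u i))|
      ≤ ∑ _i : Fin 3, ∑ _j : Fin 3, 1 * convBound u w :=
    (Finset.abs_sum_le_sum_abs _ _).trans (Finset.sum_le_sum fun i _ =>
      (Finset.abs_sum_le_sum_abs _ _).trans (Finset.sum_le_sum fun j _ => h1 i j))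
  have h4 : |∑ i, triple (u i) (w i) (divg u)| ≤ ∑ _i : Fin 3, 3 * convBound u w :=
    (Finset.abs_sum_le_sum_abs _ _).trans (Finset.sum_le_sum fun i _ => h2 i)
  simp only [Finset.sum_const, Finset.card_univ, Fintype.card_fin, nsmul_eq_mul] at h3 h4
  push_cast at h3 h4
  have h0 := convBound_nonneg u w
  -- Nine gradient terms and half of three divergence terms of weight 3: 9 + 9/2 ≤ 14.
  rw [trilinear_symmetrized_eq D hu hw, abs_le]
  constructor <;> linarith [abs_le.1 h3, abs_le.1 h4]

/-- The default value 0 of `toL2` also obeys the bound, so square integrability need not be checked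
separately. -/
theorem norm_toL2_le {f : Torus → ℝ} {c : ℝ} (hc : 0 ≤ c)
    (h : eLpNorm f 2 volume ≤ ENNReal.ofReal c) : ‖toL2 f‖ ≤ c := by
  by_cases hf : MemLp f 2 (volume : Measure Torus)
  · rw [eLpNorm_toL2 hf] at h
    exact (ENNReal.ofReal_le_ofReal_iff hc).1 h
  · rw [toL2, dif_neg hf]; simpa using hc

theorem norm_toL2_sq_le {u : VecL2} (hu : MemH1Vec u) :
    ‖toL2 (fun x => ∑ i, u i x * u i x)‖
      ≤ 3 * (√‖u‖ * √(13 * h1Norm u) * (13 * h1Norm u)) := by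
  have hy := h1Norm_nonneg u
  refine norm_toL2_le (by positivity) ?_
  have hm : ∀ i, AEStronglyMeasurable (fun x => u i x * u i x) volume := fun i =>
    (Lp.aestronglyMeasurable (u i)).mul (Lp.aestronglyMeasurable (u i))
  have h1 : ∀ i, eLpNorm (fun x => u i x * u i x) 2 volume
      ≤ ENNReal.ofReal (√‖u‖ * √(13 * h1Norm u) * (13 * h1Norm u)) := by
    intro i
    rw [eLpNorm_eq_lintegral_rpow_enorm_toReal (by norm_num) (by norm_num)]
    have e : ∀ x, ‖u i x * u i x‖ₑ ^ (2 : ℝ≥0∞).toReal = ‖u i x‖ₑ ^ 4 := by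
      intro x
      rw [enorm_mul, ← sq, pow_rpow_eq_rpow_mul, ← ENNReal.rpow_natCast]
      norm_num
    simp_rw [e]
    have h2 : ENNReal.ofReal (‖u i‖ * sobNorm (u i) ^ 3)
        ≤ ENNReal.ofReal ((√‖u‖ * √(13 * h1Norm u) * (13 * h1Norm u)) ^ 2) := by
      refine ENNReal.ofReal_le_ofReal ?_
      rw [mul_pow, mul_pow, Real.sq_sqrt (norm_nonneg _), Real.sq_sqrt (by positivity)]
      have hs := sobNorm_nonneg (u i)
      calc ‖u i‖ * sobNorm (u i) ^ 3 ≤ ‖u‖ * (13 * h1Norm u) ^ 3 := by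
            gcongr
            · exact norm_apply_le_norm u i
            · exact sobNorm_le_h1Norm u i
        _ = _ := by ring
    refine (ENNReal.rpow_le_rpow ((hu i).lintegral_enorm_pow_four_le.trans h2)
      (by norm_num)).trans ?_
    rw [ENNReal.ofReal_pow (by positivity), pow_rpow_eq_rpow_mul]
    norm_num
  have hs : (fun x => ∑ i, u i x * u i x) = ∑ i, fun x => u i x * u i x := by
    ext x; simp
  rw [hs]
  refine (eLpNorm_sum_le (fun i _ => hm i) (by norm_num)).trans
    ((Finset.sum_le_sum fun i _ => h1 i).trans ?_)
  rw [← ENNReal.ofReal_sum_of_nonneg (fun _ _ => by positivity)]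
  simp

/-- The discretized convective term does no work on discretely divergence free fields. -/
theorem trilinear_self {D : DiscretePair} (κ : Convection) {u : VecL2} (hu : D.MemV u) :
    trilinear D κ u u u = 0 := by
  have hu1 := (D.memX u hu.1).1
  cases κ with
  | symmetrized => exact trilinear_symmetrized_self D hu1
  | rotational => exact rotForm_self hu1
  | rotationalBernoulli =>
    have hq : D.projM (toL2 (fun x => ∑ i, u i x * u i x)) ∈ D.M :=
      D.M.starProjection_apply_mem _
    -- The projected Bernoulli potential lies in M_h, so after integration by parts discrete
    -- incompressibility annihilates it.
    rw [trilinear, rotForm_self hu1, inner_grad_eq_neg (D.memM _ hq).1 hu1, real_inner_comm,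
      hu.2 _ hq]
    simp

/-- The largest constant comes from the Bernoulli form, 12 + 9/2 ≤ 17. There the gradient is moved
onto `w`, because 𝒦_h is a contraction in L² while nothing is known of its effect on derivatives. -/
theorem abs_trilinear_le (D : DiscretePair) (κ : Convection) {u w : VecL2} (hu : MemH1Vec u)
    (hw : MemH1Vec w) : |trilinear D κ u u w| ≤ 17 * convBound u w := by
  have h0 := convBound_nonneg u w
  cases κ with
  | symmetrized => exact (abs_trilinear_symmetrized_le D hu hw).trans (by linarith)
  | rotational => exact (abs_rotForm_le hu hw).trans (by linarith)
  | rotationalBernoulli =>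
    have hq : D.projM (toL2 (fun x => ∑ i, u i x * u i x)) ∈ D.M :=
      D.M.starProjection_apply_mem _
    have h1 := abs_rotForm_le hu hw
    have h2 : |inner ℝ (grad (D.projM (toL2 (fun x => ∑ i, u i x * u i x)))) w|
        ≤ 9 * convBound u w := by
      have hy := h1Norm_nonneg u
      rw [inner_grad_eq_neg (D.memM _ hq).1 hw, abs_neg]
      refine (abs_real_inner_le_norm _ _).trans ?_
      have h3 : ‖D.projM (toL2 (fun x => ∑ i, u i x * u i x))‖
          ≤ 3 * (√‖u‖ * √(13 * h1Norm u) * (13 * h1Norm u)) :=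
        (D.M.norm_starProjection_apply_le _).trans (norm_toL2_sq_le hu)
      refine (mul_le_mul h3 (norm_divg_le w) (norm_nonneg _) (by positivity)).trans (le_of_eq ?_)
      rw [convBound]; ring
    rw [trilinear, abs_le]
    constructor <;> linarith [abs_le.1 h1, abs_le.1 h2]


/-! ## The discrete inf-sup condition -/

theorem grad_add {q r : L2} (hq : MemH1 q) (hr : MemH1 r) : grad (q + r) = grad q + grad r := by
  ext1 i; exact weakDeriv_add hq hr i

theorem grad_sub {q r : L2} (hq : MemH1 q) (hr : MemH1 r) : grad (q - r) = grad q - grad r := by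
  ext1 i; exact weakDeriv_sub hq hr i

theorem grad_smul {q : L2} (c : ℝ) (hq : MemH1 q) : grad (c • q) = c • grad q := by
  ext1 i; exact weakDeriv_smul hq c i

theorem zeroMeanVec_grad {q : L2} (hq : MemH1 q) : ZeroMeanVec (grad q) := by
  intro i
  have h1 : MemH1 oneL2 := fun j => ⟨0, hasWeakDeriv_oneL2 j⟩
  rw [zeroMean_iff]
  change inner ℝ oneL2 (weakDeriv i q) = 0
  have := inner_weakDeriv h1 hq i
  rw [(hasWeakDeriv_oneL2 i).weakDeriv_eq, inner_zero_left] at this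
  linarith

theorem h1Norm_grad_le (q : L2) : h1Norm (grad q) ≤ h2Norm q := by
  refine Real.sqrt_le_sqrt ?_
  have : 0 ≤ ‖q‖ ^ 2 := by positivity
  have h : ∑ i, ‖grad (grad q i)‖ ^ 2 = ∑ i, ‖grad (weakDeriv i q)‖ ^ 2 := rfl
  rw [h]
  linarith

theorem h1Norm_add_le {u v : VecL2} (hu : MemH1Vec u) (hv : MemH1Vec v) :
    h1Norm (u + v) ≤ 2 * (h1Norm u + h1Norm v) := by
  have hu0 := h1Norm_nonneg u
  have hv0 := h1Norm_nonneg v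
  have key : ∀ {E : Type} [NormedAddCommGroup E] (a b : E),
      ‖a + b‖ ^ 2 ≤ 2 * ‖a‖ ^ 2 + 2 * ‖b‖ ^ 2 := by
    intro E _ a b
    have := norm_add_le a b
    nlinarith [sq_nonneg (‖a‖ - ‖b‖), norm_nonneg (a + b), norm_nonneg a, norm_nonneg b]
  refine Real.sqrt_le_iff.2 ⟨by positivity, ?_⟩
  have h1 : ∑ i, ‖grad ((u + v) i)‖ ^ 2
      ≤ ∑ i, (2 * ‖grad (u i)‖ ^ 2 + 2 * ‖grad (v i)‖ ^ 2) := by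
    refine Finset.sum_le_sum fun i _ => ?_
    rw [PiLp.add_apply, grad_add (hu i) (hv i)]
    exact key _ _
  rw [Finset.sum_add_distrib, ← Finset.mul_sum, ← Finset.mul_sum] at h1
  nlinarith [key u v, h1Norm_sq u, h1Norm_sq v, mul_nonneg hu0 hv0]

theorem DiscretePair.proj_mem (D : DiscretePair) (v : VecL2) : D.proj v ∈ D.X :=
  D.X.starProjection_apply_mem v

theorem DiscretePair.norm_proj_le (D : DiscretePair) (v : VecL2) : ‖D.proj v‖ ≤ ‖v‖ :=
  D.X.norm_starProjection_apply_le v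

theorem DiscretePair.inner_proj (D : DiscretePair) {w : VecL2} (hw : w ∈ D.X) (v : VecL2) :
    inner ℝ w (D.proj v) = inner ℝ w v := by
  have := D.X.starProjection_inner_eq_zero v w hw
  rw [inner_sub_left, sub_eq_zero] at this
  rw [real_inner_comm, real_inner_comm v w]
  exact this.symm

/-- Solvability of the discrete Poisson problem. -/
theorem DiscretePair.exists_discrete_poisson (D : DiscretePair) {c : ℝ} (hc : 0 < c)
    (hco : ∀ q ∈ D.M, c * ‖q‖ ≤ ‖D.proj (grad q)‖) (f : VecL2) :
    ∃ ψ ∈ D.M, ∀ r ∈ D.M, inner ℝ (D.proj (grad ψ)) (grad r) = inner ℝ f (grad r) := by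
  let g : D.M →ₗ[ℝ] VecL2 :=
    { toFun := fun r => grad (r : L2)
      map_add' := fun q r => grad_add (D.memM _ q.2).1 (D.memM _ r.2).1
      map_smul' := fun a r => grad_smul a (D.memM _ r.2).1 }
  let G : D.M →ₗ[ℝ] VecL2 := (D.X.starProjection : VecL2 →ₗ[ℝ] VecL2).comp g
  let L : D.M →ₗ[ℝ] Module.Dual ℝ D.M := (innerₗ VecL2).compl₁₂ G g
  have hL : ∀ ψ r, L ψ r = inner ℝ (D.proj (grad (ψ : L2))) (grad (r : L2)) := fun _ _ => rfl
  -- On the diagonal the form equals ‖π_h∇ψ‖², which coercivity bounds below by c²‖ψ‖²; in finite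
  -- dimension injectivity then gives surjectivity.
  have hinj : Function.Injective L := by
    rw [injective_iff_map_eq_zero]
    intro ψ hψ
    have h1 : L ψ ψ = 0 := by rw [hψ]; rfl
    rw [hL, ← D.inner_proj (D.proj_mem _), real_inner_self_eq_norm_sq] at h1
    have h2 : ‖D.proj (grad (ψ : L2))‖ = 0 := by simpa using h1
    have h3 := hco ψ ψ.2
    rw [h2] at h3
    have h4 : ‖(ψ : L2)‖ = 0 := le_antisymm (by nlinarith) (norm_nonneg _)
    exact Subtype.ext (norm_eq_zero.1 h4)
  have hsurj := (LinearMap.injective_iff_surjective_of_finrank_eq_finrank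
    (Subspace.dual_finrank_eq (K := ℝ) (V := D.M)).symm).1 hinj
  obtain ⟨ψ, hψ⟩ := hsurj ((innerₗ VecL2 f).comp g)
  refine ⟨ψ, ψ.2, fun r hr => ?_⟩
  exact LinearMap.congr_fun hψ ⟨r, hr⟩

/-- The test function is v = π_h∇ψ, where ψ = ψ_h(q) and -Δq = p. Then (p, div v) = -(∇p, v) = -(∇p,
∇q) = -‖p‖². Orthogonality to V_h removes the discrete time derivative when the momentum equation is
tested with v. -/
theorem Admissible.exists_inf_sup {H : Set ℝ} {D : ℝ → DiscretePair} (hD : Admissible H D) :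
    ∃ C : ℝ, 0 < C ∧ ∀ h ∈ H, ∀ p ∈ (D h).M, ∃ v ∈ (D h).X,
      inner ℝ p (divg v) = - ‖p‖ ^ 2 ∧ h1Norm v ≤ C * ‖p‖ ∧
      ∀ δ, (D h).MemV δ → inner ℝ δ v = 0 := by
  obtain ⟨c, hc, hco⟩ := hD.coercive
  obtain ⟨cs, hcs⟩ := hD.projStable
  obtain ⟨ci, hci⟩ := hD.inverse
  obtain ⟨cp, hcp⟩ := hD.poissonApprox
  refine ⟨2 * (|ci| * |cp| + |cs|) * 4 + 1, by positivity, fun h hh p hp => ?_⟩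
  have hpos := hD.pos h hh
  obtain ⟨hp1, hp0⟩ := (D h).memM p hp
  obtain ⟨q, hq2, hq0, hqn, hq⟩ := exists_poisson hp0
  obtain ⟨ψ, hψM, hψ⟩ := (D h).exists_discrete_poisson hc (hco h hh) (grad q)
  have hψ1 := ((D h).memM ψ hψM).1
  have hvX : (D h).proj (grad ψ) ∈ (D h).X := (D h).proj_mem _
  have hv1 := ((D h).memX _ hvX).1
  refine ⟨_, hvX, ?_, ?_, ?_⟩
  · have h1 := inner_grad_eq_neg hp1 hv1
    rw [real_inner_comm, hψ p hp, hq p hp1, real_inner_self_eq_norm_sq] at h1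
    linarith
  · have hq2n : 0 ≤ h2Norm q := Real.sqrt_nonneg _
    -- The inverse inequality costs h⁻¹ on the first part, which the rate h of ψ_h repays; the
    -- second part is controlled by the H¹ stability of π_h.
    have e : (D h).proj (grad ψ) = (D h).proj (grad (ψ - q)) + (D h).proj (grad q) := by
      rw [grad_sub hψ1 hq2.1]
      simp [DiscretePair.proj]
    have b1 : h1Norm ((D h).proj (grad (ψ - q))) ≤ |ci| * |cp| * h2Norm q := by
      calc h1Norm ((D h).proj (grad (ψ - q)))
          ≤ ci * h⁻¹ * ‖(D h).proj (grad (ψ - q))‖ := hci h hh _ ((D h).proj_mem _)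
        _ ≤ |ci| * h⁻¹ * (|cp| * h * h2Norm q) := by
            gcongr
            · exact le_abs_self ci
            · refine ((D h).norm_proj_le _).trans
                ((hcp h hh q hq2 hq0 ψ hψM hψ).trans ?_)
              gcongr
              exact le_abs_self cp
        _ = |ci| * |cp| * h2Norm q := by field_simp
    have b2 : h1Norm ((D h).proj (grad q)) ≤ |cs| * h2Norm q := by
      calc h1Norm ((D h).proj (grad q)) ≤ cs * h1Norm (grad q) :=
            hcs h hh _ hq2.2 (zeroMeanVec_grad hq2.1)
        _ ≤ |cs| * h2Norm q := by
            gcongr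
            · exact h1Norm_nonneg _
            · exact le_abs_self cs
            · exact h1Norm_grad_le q
    rw [e]
    refine (h1Norm_add_le ((D h).memX _ ((D h).proj_mem _)).1
      ((D h).memX _ ((D h).proj_mem _)).1).trans ?_
    calc 2 * (h1Norm ((D h).proj (grad (ψ - q))) + h1Norm ((D h).proj (grad q)))
        ≤ 2 * (|ci| * |cp| + |cs|) * h2Norm q := by linarith
      _ ≤ 2 * (|ci| * |cp| + |cs|) * (4 * ‖p‖) := by gcongr
      _ ≤ (2 * (|ci| * |cp| + |cs|) * 4 + 1) * ‖p‖ := by nlinarith [norm_nonneg p]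
  · intro δ hδ
    have hδ1 := ((D h).memX δ hδ.1).1
    -- (δ, π_h∇ψ) = (δ, ∇ψ) = -(div δ, ψ) = 0, since δ ∈ X_h and ψ ∈ M_h.
    rw [(D h).inner_proj hδ.1, real_inner_comm, inner_grad_eq_neg hψ1 hδ1, real_inner_comm,
      hδ.2 ψ hψM, neg_zero]

/-! ## Energy estimate -/

theorem DiscretePair.MemV.add {D : DiscretePair} {u v : VecL2} (hu : D.MemV u) (hv : D.MemV v) :
    D.MemV (u + v) := by
  refine ⟨D.X.add_mem hu.1 hv.1, fun q hq => ?_⟩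
  rw [divg_add (D.memX u hu.1).1 (D.memX v hv.1).1, inner_add_left, hu.2 q hq, hv.2 q hq, add_zero]

theorem DiscretePair.MemV.smul {D : DiscretePair} {u : VecL2} (c : ℝ) (hu : D.MemV u) :
    D.MemV (c • u) := by
  refine ⟨D.X.smul_mem c hu.1, fun q hq => ?_⟩
  rw [divg_smul c (D.memX u hu.1).1, real_inner_smul_left, hu.2 q hq, mul_zero]

theorem DiscretePair.MemV.sub {D : DiscretePair} {u v : VecL2} (hu : D.MemV u) (hv : D.MemV v) :
    D.MemV (u - v) := by
  have := hu.add (hv.smul (-1))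
  simpa [sub_eq_add_neg] using this

namespace IsCNSolution

variable {D : DiscretePair} {κ : Convection} {ν dt : ℝ} {N : ℕ} {u₀ : VecL2}
    {u : ℕ → VecL2} {p : ℕ → L2}

theorem memV (S : IsCNSolution D κ ν dt N u₀ u p) {m : ℕ} (hm : m ≤ N) : D.MemV (u m) := by
  rcases Nat.eq_zero_or_pos m with h | h
  · subst h; exact S.init_mem
  · exact ⟨S.memX m h hm, S.incompressible m h hm⟩

theorem memV_half (S : IsCNSolution D κ ν dt N u₀ u p) {m : ℕ} (hm : m ≤ N) :
    D.MemV (half u m) :=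
  ((S.memV hm).add (S.memV ((Nat.sub_le m 1).trans hm))).smul _

/-- The midpoint value is the test function: the time difference becomes an exact difference of
squares, and the convective and pressure terms vanish on V_h. -/
theorem energy_step (S : IsCNSolution D κ ν dt N u₀ u p) (hdt : 0 < dt) {m : ℕ} (h1 : 1 ≤ m)
    (hm : m ≤ N) :
    ‖u m‖ ^ 2 + 2 * ν * dt * gradInner (half u m) (half u m) = ‖u (m - 1)‖ ^ 2 := by
  have hV := S.memV_half hm
  have h := S.momentum m h1 hm _ hV.1
  rw [trilinear_self κ hV, real_inner_comm (divg (half u m)),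
    hV.2 _ (S.memM m h1 hm)] at h
  have e : inner ℝ (u m - u (m - 1)) (half u m) = (1 / 2) * (‖u m‖ ^ 2 - ‖u (m - 1)‖ ^ 2) := by
    rw [half, inner_smul_right, inner_sub_left, inner_add_right, inner_add_right,
      real_inner_self_eq_norm_sq, real_inner_self_eq_norm_sq, real_inner_comm (u m)]
    ring
  rw [real_inner_smul_left, e] at h
  field_simp at h
  linarith

theorem norm_init_le (S : IsCNSolution D κ ν dt N u₀ u p) : ‖u 0‖ ≤ ‖u₀‖ := by
  have h := S.init_proj _ S.init_mem
  rw [real_inner_self_eq_norm_sq] at h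
  have h2 := real_inner_le_norm u₀ (u 0)
  by_contra hlt
  nlinarith [norm_nonneg (u 0), norm_nonneg u₀]

theorem energy (S : IsCNSolution D κ ν dt N u₀ u p) (hdt : 0 < dt) {m : ℕ} (hm : m ≤ N) :
    ‖u m‖ ^ 2 + 2 * ν * dt * ∑ k ∈ Finset.Icc 1 m, gradInner (half u k) (half u k)
      = ‖u 0‖ ^ 2 := by
  induction m with
  | zero => simp
  | succ m ih =>
    have h := S.energy_step hdt (Nat.le_add_left 1 m) hm
    rw [Finset.sum_Icc_succ_top (Nat.le_add_left 1 m)]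
    rw [Nat.add_sub_cancel] at h
    linarith [ih (by omega)]

theorem gradInner_self_nonneg (v : VecL2) : 0 ≤ gradInner v v := by
  rw [gradInner_self]; positivity

theorem norm_le (S : IsCNSolution D κ ν dt N u₀ u p) (hν : 0 < ν) (hdt : 0 < dt) {m : ℕ}
    (hm : m ≤ N) : ‖u m‖ ≤ ‖u₀‖ := by
  have h := S.energy hdt hm
  have h0 : 0 ≤ 2 * ν * dt * ∑ k ∈ Finset.Icc 1 m, gradInner (half u k) (half u k) :=
    mul_nonneg (by positivity) (Finset.sum_nonneg fun k _ => gradInner_self_nonneg _)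
  exact (abs_le_of_sq_le_sq' (by linarith) (norm_nonneg (u 0))).2.trans S.norm_init_le

theorem norm_half_le (S : IsCNSolution D κ ν dt N u₀ u p) (hν : 0 < ν) (hdt : 0 < dt) {m : ℕ}
    (hm : m ≤ N) : ‖half u m‖ ≤ ‖u₀‖ := by
  rw [half, norm_smul]
  have h1 := S.norm_le hν hdt hm
  have h2 := S.norm_le hν hdt ((Nat.sub_le m 1).trans hm)
  have h3 := norm_add_le (u m) (u (m - 1))
  rw [Real.norm_of_nonneg (by norm_num)]
  linarith

theorem sum_h1Norm_sq_le (S : IsCNSolution D κ ν dt N u₀ u p) (hν : 0 < ν) (hdt : 0 < dt) :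
    ∑ m ∈ Finset.Icc 1 N, dt * h1Norm (half u m) ^ 2
      ≤ N * dt * ‖u₀‖ ^ 2 + ‖u₀‖ ^ 2 / (2 * ν) := by
  have hE := S.energy hdt le_rfl
  have h0 := S.norm_init_le
  have h2 : dt * ∑ k ∈ Finset.Icc 1 N, gradInner (half u k) (half u k) ≤ ‖u₀‖ ^ 2 / (2 * ν) := by
    rw [le_div_iff₀ (by positivity)]
    nlinarith [sq_nonneg ‖u N‖, norm_nonneg (u 0), norm_nonneg u₀]
  have h3 : ∑ m ∈ Finset.Icc 1 N, dt * ‖half u m‖ ^ 2 ≤ N * dt * ‖u₀‖ ^ 2 := by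
    calc ∑ m ∈ Finset.Icc 1 N, dt * ‖half u m‖ ^ 2
        ≤ ∑ _m ∈ Finset.Icc 1 N, dt * ‖u₀‖ ^ 2 := by
          refine Finset.sum_le_sum fun m hm => ?_
          have := S.norm_half_le hν hdt (Finset.mem_Icc.1 hm).2
          gcongr
      _ = N * dt * ‖u₀‖ ^ 2 := by simp; ring
  simp_rw [h1Norm_sq, ← gradInner_self, mul_add]
  rw [Finset.sum_add_distrib, ← Finset.mul_sum (f := fun m => gradInner (half u m) (half u m))]
  linarith

end IsCNSolution

/-! ## Pressure and time derivative -/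

/-- The base 1 + ‖u‖_{H¹} is used so that the same power 3/2 also dominates the linear viscous term.
The constant is 52 = 4 · 13, with √13 ≤ 4. -/
theorem convBound_le {u w : VecL2} {R : ℝ} (hR : ‖u‖ ≤ R) :
    convBound u w ≤ 52 * √R * (1 + h1Norm u) ^ (3 / 2 : ℝ) * h1Norm w := by
  have hy := h1Norm_nonneg u
  have hw := h1Norm_nonneg w
  have e : (1 + h1Norm u) ^ (3 / 2 : ℝ) = (1 + h1Norm u) * √(1 + h1Norm u) := by
    rw [Real.sqrt_eq_rpow, ← Real.rpow_one_add' (by positivity) (by norm_num)]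
    norm_num
  have h1 : √(13 * h1Norm u) ≤ 4 * √(1 + h1Norm u) := by
    rw [show (4 : ℝ) = √16 by rw [show (16 : ℝ) = 4 ^ 2 by norm_num]; simp,
      ← Real.sqrt_mul (by norm_num)]
    exact Real.sqrt_le_sqrt (by linarith)
  rw [e, convBound]
  calc √‖u‖ * √(13 * h1Norm u) * (13 * h1Norm w) * h1Norm u
      ≤ √R * (4 * √(1 + h1Norm u)) * (13 * h1Norm w) * (1 + h1Norm u) := by
        gcongr
        linarith
    _ = _ := by ring

theorem MemH1Vec.exists_sub_mean {w : VecL2} (hw : MemH1Vec w) : ∃ w' : VecL2, MemH1Vec w' ∧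
    ZeroMeanVec w' ∧ h1Norm w' ≤ h1Norm w ∧
    ∀ δ : VecL2, ZeroMeanVec δ → inner ℝ δ w' = inner ℝ δ w := by
  choose f h1 h2 h3 h4 h5 using fun i => (hw i).exists_sub_mean
  refine ⟨WithLp.toLp 2 f, h1, h2, ?_, fun δ hδ => ?_⟩
  · refine Real.sqrt_le_sqrt (add_le_add ?_ (le_of_eq ?_))
    · rw [PiLp.norm_sq_eq_of_L2, PiLp.norm_sq_eq_of_L2]
      exact Finset.sum_le_sum fun i _ => pow_le_pow_left₀ (norm_nonneg _) (h3 i) 2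
    · refine Finset.sum_congr rfl fun i _ => ?_
      have : grad (f i) = grad (w i) := by ext1 j; exact h4 i j
      change ‖grad (f i)‖ ^ 2 = _
      rw [this]
  · rw [PiLp.inner_apply, PiLp.inner_apply]
    exact Finset.sum_congr rfl fun i _ => h5 i _ (hδ i)

/-- The viscous and convective terms together form a functional of size K Y ‖w‖_{H¹}, with Y = (1 +
‖u^{m,1/2}‖_{H¹})^{3/2}. The inf-sup test function turns this into a bound on the pressure alone,
after which a projected test function bounds the time difference. -/
theorem Admissible.exists_pressure_bound {H : Set ℝ} {D : ℝ → DiscretePair} (hD : Admissible H D)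
    {ν : ℝ} (hν : 0 < ν) (κ : Convection) (u₀ : VecL2) :
    ∃ C : ℝ, 0 < C ∧ ∀ h ∈ H, ∀ (dt : ℝ) (N : ℕ) (u : ℕ → VecL2) (p : ℕ → L2), 0 < dt →
      IsCNSolution (D h) κ ν dt N u₀ u p → ∀ m, 1 ≤ m → m ≤ N →
      ‖p m‖ ≤ C * (1 + h1Norm (half u m)) ^ (3 / 2 : ℝ) ∧
      hNegOneNorm (dt⁻¹ • (u m - u (m - 1)))
        ≤ ENNReal.ofReal (C * (1 + h1Norm (half u m)) ^ (3 / 2 : ℝ)) := by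
  obtain ⟨B, hB, hinf⟩ := hD.exists_inf_sup
  obtain ⟨cs, hcs⟩ := hD.projStable
  -- 884 = 17 · 52, from `abs_trilinear_le` and `convBound_le`.
  set K : ℝ := 3 * ν + 884 * √‖u₀‖ with hK
  have hK0 : 0 < K := by positivity
  refine ⟨K * B + (K + 3 * (K * B)) * |cs|, by positivity,
    fun h hh dt N u p hdt S m h1 hm => ?_⟩
  set Y := (1 + h1Norm (half u m)) ^ (3 / 2 : ℝ) with hY
  have hy := h1Norm_nonneg (half u m)
  have hY0 : 0 ≤ Y := by positivity
  have hV := S.memV_half hm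
  have hH1 := ((D h).memX _ hV.1).1
  have hyY : h1Norm (half u m) ≤ Y := by
    calc h1Norm (half u m) ≤ (1 + h1Norm (half u m)) ^ (1 : ℝ) := by rw [Real.rpow_one]; linarith
      _ ≤ Y := Real.rpow_le_rpow_of_exponent_le (by linarith) (by norm_num)
  have hform : ∀ w, MemH1Vec w → |ν * gradInner (half u m) w
      + trilinear (D h) κ (half u m) (half u m) w| ≤ K * Y * h1Norm w := by
    intro w hw
    have hw0 := h1Norm_nonneg w
    have b1 := abs_gradInner_le (half u m) w
    have b2 := abs_trilinear_le (D h) κ hH1 hw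
    have b3 := convBound_le (w := w) (S.norm_half_le hν hdt hm)
    calc |ν * gradInner (half u m) w + trilinear (D h) κ (half u m) (half u m) w|
        ≤ ν * |gradInner (half u m) w| + |trilinear (D h) κ (half u m) (half u m) w| := by
          refine (abs_add_le _ _).trans ?_
          rw [abs_mul, abs_of_pos hν]
      _ ≤ ν * (3 * (Y * h1Norm w)) + 17 * (52 * √‖u₀‖ * Y * h1Norm w) := by
          have b4 : h1Norm (half u m) * h1Norm w ≤ Y * h1Norm w := by gcongr
          have b5 : |gradInner (half u m) w| ≤ 3 * (Y * h1Norm w) := by linarith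
          have b6 := mul_le_mul_of_nonneg_left b5 hν.le
          linarith
      _ = K * Y * h1Norm w := by rw [hK]; ring
  have hδV : (D h).MemV (dt⁻¹ • (u m - u (m - 1))) :=
    ((S.memV hm).sub (S.memV ((Nat.sub_le m 1).trans hm))).smul _
  have hp : ‖p m‖ ≤ K * B * Y := by
    obtain ⟨v, hvX, hv1, hv2, hv3⟩ := hinf h hh (p m) (S.memM m h1 hm)
    have hmom := S.momentum m h1 hm v hvX
    rw [hv3 _ hδV, hv1] at hmom
    have hf := hform v ((D h).memX v hvX).1
    have hsq : ‖p m‖ ^ 2 ≤ K * Y * (B * ‖p m‖) := by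
      have : K * Y * h1Norm v ≤ K * Y * (B * ‖p m‖) := by gcongr
      linarith [(abs_le.1 hf).1]
    by_contra hlt
    push Not at hlt
    have h0 : 0 < ‖p m‖ := lt_of_le_of_lt (by positivity) hlt
    nlinarith
  refine ⟨hp.trans ?_, ?_⟩
  · have : 0 ≤ (K + 3 * (K * B)) * |cs| := by positivity
    gcongr
    linarith
  · refine iSup_le fun w => iSup_le fun hw => iSup_le fun hw1 => ENNReal.ofReal_le_ofReal ?_
    -- The time difference lies in X_h and has zero mean, so its pairing with `w` equals its pairing
    -- with π_h w', an admissible test function controlled in H¹.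
    obtain ⟨w', a1, a2, a3, a4⟩ := hw.exists_sub_mean
    have hvX := (D h).proj_mem w'
    have hvH := ((D h).memX _ hvX).1
    have hmom := S.momentum m h1 hm _ hvX
    rw [(D h).inner_proj hδV.1, a4 _ ((D h).memX _ hδV.1).2] at hmom
    have hf := hform _ hvH
    have hv1 : h1Norm ((D h).proj w') ≤ |cs| := by
      calc h1Norm ((D h).proj w') ≤ cs * h1Norm w' := hcs h hh w' a1 a2
        _ ≤ |cs| * 1 := by
            gcongr
            · exact h1Norm_nonneg _
            · exact le_abs_self cs
            · exact a3.trans hw1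
        _ = |cs| := mul_one _
    have hpd : inner ℝ (p m) (divg ((D h).proj w')) ≤ K * B * Y * (3 * |cs|) := by
      refine (real_inner_le_norm _ _).trans ?_
      have := norm_divg_le ((D h).proj w')
      gcongr
      linarith
    have hf2 : K * Y * h1Norm ((D h).proj w') ≤ K * Y * |cs| := by gcongr
    have : 0 ≤ K * B * Y := by positivity
    linarith [(abs_le.1 hf).1]


/-! ## Step functions in time -/

/-- The step function with value `F m` on `[t_{m-1}, t_m)`, and `F N` from `t_N` on. -/
def stepFn {E : Type*} (dt : ℝ) (N : ℕ) (F : ℕ → E) (t : ℝ) : E :=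
  if t < N * dt then F (stepIndex dt t) else F N

theorem uInterp_eq_stepFn (dt : ℝ) (N : ℕ) (u : ℕ → VecL2) :
    uInterp dt N u = stepFn dt N (half u) := rfl

theorem pInterp_eq_stepFn (dt : ℝ) (N : ℕ) (p : ℕ → L2) :
    pInterp dt N p = stepFn dt N p := rfl

theorem comp_stepFn {E G : Type*} (φ : E → G) (dt : ℝ) (N : ℕ) (F : ℕ → E) (t : ℝ) :
    φ (stepFn dt N F t) = stepFn dt N (fun m => φ (F m)) t := by
  unfold stepFn; split_ifs <;> rfl

theorem stronglyMeasurable_stepFn {E : Type*} [TopologicalSpace E]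
    [TopologicalSpace.PseudoMetrizableSpace E] (dt : ℝ) (N : ℕ)
    (F : ℕ → E) : StronglyMeasurable (stepFn dt N F) := by
  have hi : Measurable (stepIndex dt) := by
    unfold stepIndex
    exact (Nat.measurable_floor.comp (measurable_id.div_const dt)).add_const 1
  exact StronglyMeasurable.ite (measurableSet_lt measurable_id measurable_const)
    ((StronglyMeasurable.of_discrete (f := F)).comp_measurable hi) stronglyMeasurable_const

section

variable {E : Type*} {dt T : ℝ} {N : ℕ}

theorem stepIndex_eq (hdt : 0 < dt) {m : ℕ} {t : ℝ} (h1 : m * dt ≤ t) (h2 : t < (m + 1) * dt) :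
    stepIndex dt t = m + 1 := by
  have h0 : 0 ≤ t / dt := by
    have : 0 ≤ (m : ℝ) * dt := by positivity
    exact div_nonneg (this.trans h1) hdt.le
  rw [stepIndex, (Nat.floor_eq_iff h0).2 ⟨(le_div_iff₀ hdt).2 h1, (div_lt_iff₀ hdt).2 h2⟩]

theorem stepFn_eq (hdt : 0 < dt) (F : ℕ → E) {m : ℕ} (hm : m < N) {t : ℝ}
    (h1 : m * dt ≤ t) (h2 : t < (m + 1) * dt) : stepFn dt N F t = F (m + 1) := by
  have h3 : ((m + 1 : ℕ) : ℝ) * dt ≤ N * dt := by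
    have : ((m + 1 : ℕ) : ℝ) ≤ N := by exact_mod_cast hm
    gcongr
  push_cast at h3
  rw [stepFn, if_pos (h2.trans_le h3), stepIndex_eq hdt h1 h2]

theorem exists_cell (hdt : 0 < dt) {t : ℝ} (h0 : 0 ≤ t) (ht : t < N * dt) :
    ∃ m < N, m * dt ≤ t ∧ t < (m + 1) * dt := by
  have h0' : 0 ≤ t / dt := div_nonneg h0 hdt.le
  refine ⟨⌊t / dt⌋₊, ?_, ?_, ?_⟩
  · exact (Nat.floor_lt h0').2 ((div_lt_iff₀ hdt).2 ht)
  · exact (le_div_iff₀ hdt).1 (Nat.floor_le h0')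
  · exact (div_lt_iff₀ hdt).1 (Nat.lt_floor_add_one _)

theorem exists_stepFn_eq (hdt : 0 < dt) (hN : 1 ≤ N) (F : ℕ → E) {t : ℝ} (h0 : 0 ≤ t) :
    ∃ m, 1 ≤ m ∧ m ≤ N ∧ stepFn dt N F t = F m := by
  by_cases ht : t < N * dt
  · obtain ⟨m, hm, h1, h2⟩ := exists_cell hdt h0 ht
    exact ⟨m + 1, by omega, hm, stepFn_eq hdt F hm h1 h2⟩
  · exact ⟨N, hN, le_rfl, by rw [stepFn, if_neg ht]⟩

theorem sum_Icc_one {M : Type*} [AddCommMonoid M] (f : ℕ → M) (n : ℕ) :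
    ∑ m ∈ Finset.Icc 1 n, f m = ∑ k ∈ Finset.range n, f (k + 1) := by
  induction n with
  | zero => simp
  | succ n ih => rw [Finset.sum_Icc_succ_top (Nat.le_add_left 1 n), ih, Finset.sum_range_succ]

theorem lintegral_stepFn (hdt : 0 < dt) (hT : N * dt = T) (G : ℕ → ℝ≥0∞) :
    ∫⁻ t, stepFn dt N G t ∂(timeMeasure T)
      = ∑ m ∈ Finset.Icc 1 N, ENNReal.ofReal dt * G m := by
  have key : ∀ n ≤ N, ∫⁻ t in Set.Ico 0 (n * dt), stepFn dt N G t
      = ∑ m ∈ Finset.Icc 1 n, ENNReal.ofReal dt * G m := by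
    intro n
    induction n with
    | zero => simp
    | succ n ih =>
      intro hn
      have h0 : 0 ≤ (n : ℝ) * dt := by positivity
      have h1 : (n : ℝ) * dt ≤ ((n + 1 : ℕ) : ℝ) * dt := by push_cast; nlinarith
      rw [← Set.Ico_union_Ico_eq_Ico h0 h1, lintegral_union measurableSet_Ico
        (Set.Ico_disjoint_Ico_same), ih (by omega),
        Finset.sum_Icc_succ_top (Nat.le_add_left 1 n)]
      congr 1
      rw [setLIntegral_congr_fun (g := fun _ => G (n + 1)) measurableSet_Ico
        (fun t ht => stepFn_eq hdt G hn ht.1 (by simpa using ht.2)), setLIntegral_const,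
        Real.volume_Ico, mul_comm]
      congr 2
      push_cast; ring
  rw [timeMeasure, ← hT, setLIntegral_congr Ico_ae_eq_Icc.symm]
  exact key N le_rfl

/-- Only an extended norm is required of the values, so that the lemma covers the `ℝ≥0∞`-valued H⁻¹
norm along with L² and real values. -/
theorem eLpNorm_stepFn_le {E : Type*} [TopologicalSpace E] [ContinuousENorm E] (hdt : 0 < dt)
    (hT : N * dt = T) {F : ℕ → E} {a : ℕ → ℝ} {r B : ℝ} (hr : 0 < r) (ha : ∀ m, 0 ≤ a m)
    (hB : 0 ≤ B) (hF : ∀ m, 1 ≤ m → m ≤ N → ‖F m‖ₑ ≤ ENNReal.ofReal (a m))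
    (hs : ∑ m ∈ Finset.Icc 1 N, dt * a m ^ r ≤ B) :
    eLpNorm (stepFn dt N F) (ENNReal.ofReal r) (timeMeasure T)
      ≤ ENNReal.ofReal (B ^ (1 / r)) := by
  rw [eLpNorm_eq_lintegral_rpow_enorm_toReal (by simpa using hr) ENNReal.ofReal_ne_top,
    ENNReal.toReal_ofReal hr.le, ← ENNReal.ofReal_rpow_of_nonneg hB (by positivity)]
  refine ENNReal.rpow_le_rpow ?_ (by positivity)
  simp_rw [comp_stepFn (fun x : E => ‖x‖ₑ ^ r)]
  rw [lintegral_stepFn hdt hT]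
  refine le_trans ?_ (ENNReal.ofReal_le_ofReal hs)
  rw [ENNReal.ofReal_sum_of_nonneg
    (fun m _ => mul_nonneg hdt.le (Real.rpow_nonneg (ha m) r))]
  refine Finset.sum_le_sum fun m hm => ?_
  obtain ⟨h1, h2⟩ := Finset.mem_Icc.1 hm
  rw [ENNReal.ofReal_mul hdt.le, ← ENNReal.ofReal_rpow_of_nonneg (ha m) hr.le]
  gcongr
  exact hF m h1 h2

end

/-! ## The piecewise linear interpolant -/

section

variable {dt T : ℝ} {N : ℕ} {u : ℕ → VecL2}

/-- The formula persists at the right end of the cell, where the index has already jumped or the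
final branch applies: both give `u (m + 1)`. This is what lets the closed cells be glued
continuously. -/
theorem vInterp_eq (hdt : 0 < dt) {m : ℕ} (hm : m < N) {t : ℝ} (h1 : m * dt ≤ t)
    (h2 : t ≤ (m + 1) * dt) :
    vInterp dt N u t = u m + ((t - m * dt) / dt) • (u (m + 1) - u m) := by
  rcases h2.lt_or_eq with h2 | h2
  · have h3 : ((m + 1 : ℕ) : ℝ) * dt ≤ N * dt := by
      have : ((m + 1 : ℕ) : ℝ) ≤ N := by exact_mod_cast hm
      gcongr
    push_cast at h3
    rw [vInterp, if_pos (h2.trans_le h3), stepIndex_eq hdt h1 h2, Nat.add_sub_cancel]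
  · have e : (t - m * dt) / dt = 1 := by rw [h2]; field_simp; ring
    rw [e, one_smul, add_sub_cancel]
    rcases Nat.lt_or_ge (m + 1) N with h | h
    · have h3 : t < N * dt := by
        have : ((m + 1 : ℕ) : ℝ) < N := by exact_mod_cast h
        push_cast at this
        rw [h2]; gcongr
      have h4 : stepIndex dt t = m + 1 + 1 :=
        stepIndex_eq hdt (by push_cast; exact h2.ge) (by push_cast; nlinarith)
      rw [vInterp, if_pos h3, h4, Nat.add_sub_cancel, h2]
      simp
    · have h5 : N = m + 1 := by omega
      rw [vInterp, if_neg (by rw [h2, h5]; push_cast; exact lt_irrefl _), h5]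

theorem exists_closed_cell (hdt : 0 < dt) (hN : 1 ≤ N) {t : ℝ} (h0 : 0 ≤ t) (ht : t ≤ N * dt) :
    ∃ m < N, m * dt ≤ t ∧ t ≤ (m + 1) * dt := by
  rcases ht.lt_or_eq with ht | ht
  · obtain ⟨m, hm, h1, h2⟩ := exists_cell hdt h0 ht
    exact ⟨m, hm, h1, h2.le⟩
  · obtain ⟨n, rfl⟩ : ∃ n, N = n + 1 := ⟨N - 1, by omega⟩
    push_cast at ht
    exact ⟨n, by omega, by nlinarith, ht.le⟩

theorem continuousOn_vInterp (hdt : 0 < dt) (hT : N * dt = T) :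
    ContinuousOn (vInterp dt N u) (Set.Icc 0 T) := by
  have key : ∀ n ≤ N, ContinuousOn (vInterp dt N u) (Set.Icc 0 (n * dt)) := by
    intro n
    induction n with
    | zero => simp
    | succ n ih =>
      intro hn
      have h0 : 0 ≤ (n : ℝ) * dt := by positivity
      have h1 : (n : ℝ) * dt ≤ ((n + 1 : ℕ) : ℝ) * dt := by push_cast; nlinarith
      rw [← Set.Icc_union_Icc_eq_Icc h0 h1]
      refine (ih (by omega)).union_of_isClosed ?_ isClosed_Icc isClosed_Icc
      refine ContinuousOn.congr (f := fun t => u n + ((t - n * dt) / dt) • (u (n + 1) - u n))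
        (by fun_prop) fun t ht => ?_
      exact vInterp_eq hdt hn ht.1 (by simpa using ht.2)
  rw [← hT]
  exact key N le_rfl

theorem norm_vInterp_le (hdt : 0 < dt) (hN : 1 ≤ N) (hT : N * dt = T) {R : ℝ}
    (hR : ∀ m ≤ N, ‖u m‖ ≤ R) {t : ℝ} (ht : t ∈ Set.Icc 0 T) : ‖vInterp dt N u t‖ ≤ R := by
  obtain ⟨m, hm, h1, h2⟩ := exists_closed_cell hdt hN ht.1 (by rw [hT]; exact ht.2)
  rw [vInterp_eq hdt hm h1 h2]
  set s := (t - m * dt) / dt with hs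
  have hs0 : 0 ≤ s := div_nonneg (by linarith) hdt.le
  have hs1 : s ≤ 1 := by rw [hs, div_le_one hdt]; linarith
  have e : u m + s • (u (m + 1) - u m) = (1 - s) • u m + s • u (m + 1) := by module
  rw [e]
  refine (norm_add_le _ _).trans ?_
  rw [norm_smul, norm_smul, Real.norm_of_nonneg hs0, Real.norm_of_nonneg (by linarith)]
  nlinarith [hR m hm.le, hR (m + 1) hm]

theorem hasDerivAt_vInterp (hdt : 0 < dt) {m : ℕ} (hm : m < N) {t : ℝ} (h1 : m * dt < t)
    (h2 : t < (m + 1) * dt) :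
    HasDerivAt (vInterp dt N u) (dt⁻¹ • (u (m + 1) - u m)) t := by
  have h : HasDerivAt (fun t : ℝ => u m + ((t - m * dt) / dt) • (u (m + 1) - u m))
      (dt⁻¹ • (u (m + 1) - u m)) t := by
    have := ((((hasDerivAt_id t).sub_const (m * dt)).div_const dt).smul_const
      (u (m + 1) - u m)).const_add (u m)
    simpa using this
  refine h.congr_of_eventuallyEq ?_
  filter_upwards [Ioo_mem_nhds h1 h2] with s hs
  exact vInterp_eq hdt hm hs.1.le hs.2.le

/-- The grid points of the time discretization. -/
def timeGrid (dt : ℝ) : Set ℝ := Set.range fun k : ℕ => (k : ℝ) * dt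

theorem countable_timeGrid (dt : ℝ) : (timeGrid dt).Countable := Set.countable_range _

theorem hasDerivAt_vInterp_stepFn (hdt : 0 < dt) (hT : N * dt = T) {t : ℝ}
    (ht : t ∈ Set.Icc 0 T) (hg : t ∉ timeGrid dt) :
    HasDerivAt (vInterp dt N u) (stepFn dt N (fun m => dt⁻¹ • (u m - u (m - 1))) t) t := by
  have hlt : t < N * dt := by
    rw [hT]
    exact lt_of_le_of_ne ht.2 fun h => hg ⟨N, by rw [h]; exact hT⟩
  obtain ⟨m, hm, h1, h2⟩ := exists_cell hdt ht.1 hlt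
  rw [stepFn_eq hdt _ hm h1 h2, Nat.add_sub_cancel]
  exact hasDerivAt_vInterp hdt hm (lt_of_le_of_ne h1 fun h => hg ⟨m, h⟩) h2

theorem ae_hasDerivAt_vInterp (hdt : 0 < dt) (hT : N * dt = T) : ∀ᵐ t ∂(timeMeasure T),
    HasDerivAt (vInterp dt N u) (stepFn dt N (fun m => dt⁻¹ • (u m - u (m - 1))) t) t := by
  rw [timeMeasure, ae_restrict_iff' measurableSet_Icc]
  filter_upwards [(countable_timeGrid dt).ae_notMem volume] with t hg ht
  exact hasDerivAt_vInterp_stepFn hdt hT ht hg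

theorem integrable_deriv_vInterp (hdt : 0 < dt) (hN : 1 ≤ N) (hT : N * dt = T) :
    Integrable (deriv (vInterp dt N u)) (timeMeasure T) := by
  set δ : ℕ → VecL2 := fun m => dt⁻¹ • (u m - u (m - 1)) with hδ
  have : IsFiniteMeasure (timeMeasure T) := by unfold timeMeasure; infer_instance
  have hi : Integrable (stepFn dt N δ) (timeMeasure T) := by
    refine Integrable.of_bound (stronglyMeasurable_stepFn dt N δ).aestronglyMeasurable
      (∑ m ∈ Finset.Icc 1 N, ‖δ m‖) ?_
    rw [timeMeasure, ae_restrict_iff' measurableSet_Icc]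
    refine Eventually.of_forall fun t ht => ?_
    obtain ⟨m, h1, h2, h3⟩ := exists_stepFn_eq hdt hN δ ht.1
    rw [h3]
    exact Finset.single_le_sum (f := fun m => ‖δ m‖) (fun _ _ => norm_nonneg _)
      (Finset.mem_Icc.2 ⟨h1, h2⟩)
  refine hi.congr ?_
  filter_upwards [ae_hasDerivAt_vInterp (u := u) hdt hT] with t ht
  exact ht.deriv.symm

/-- The interpolant is continuous and differentiable off the countable grid, with integrable
derivative, so the fundamental theorem of calculus applies: the pointwise derivative is the genuine
time derivative. -/
theorem vInterp_sub_eq_integral (hdt : 0 < dt) (hN : 1 ≤ N) (hT : N * dt = T) {s t : ℝ}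
    (hs : s ∈ Set.Icc 0 T) (ht : t ∈ Set.Icc 0 T) :
    IntervalIntegrable (deriv (vInterp dt N u)) volume s t ∧
      vInterp dt N u t - vInterp dt N u s = ∫ τ in s..t, deriv (vInterp dt N u) τ := by
  have hsub : Set.uIcc s t ⊆ Set.Icc 0 T := Set.uIcc_subset_Icc hs ht
  have hi : IntervalIntegrable (deriv (vInterp dt N u)) volume s t := by
    rw [intervalIntegrable_iff]
    exact IntegrableOn.mono_set (integrable_deriv_vInterp hdt hN hT)
      (Set.uIoc_subset_uIcc.trans hsub)
  refine ⟨hi, (integral_eq_of_hasDerivAt_off_countable _ _ (countable_timeGrid dt)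
    ((continuousOn_vInterp hdt hT).mono hsub) (fun x hx => ?_) hi).symm⟩
  have hx' : x ∈ Set.Icc 0 T := hsub ⟨hx.1.1.le, hx.1.2.le⟩
  exact (hasDerivAt_vInterp_stepFn hdt hT hx' hx.2).differentiableAt.hasDerivAt

theorem integral_half_sub_sq (hdt : 0 < dt) (a : ℝ) :
    ∫ t in a..(a + dt), (1 / 2 - (t - a) / dt) ^ 2 = dt / 12 := by
  have h : ∀ t ∈ Set.uIcc a (a + dt), HasDerivAt
      (fun t : ℝ => -(dt / 3) * (1 / 2 - (t - a) / dt) ^ 3) ((1 / 2 - (t - a) / dt) ^ 2) t := by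
    intro t _
    have h1 := ((((((hasDerivAt_id t).sub_const a).div_const dt).const_sub (1 / 2)).fun_pow 3).const_mul
      (-(dt / 3)))
    refine h1.congr_deriv ?_
    simp only [id_eq, Nat.cast_ofNat, Nat.add_one_sub_one]
    field_simp
  rw [intervalIntegral.integral_eq_sub_of_hasDerivAt h
    (Continuous.intervalIntegrable (by fun_prop) _ _)]
  have : (a + dt - a) / dt = 1 := by field_simp; ring
  rw [this, sub_self, zero_div]
  ring

/-- On each cell the difference is (1/2 - θ)(u^m - u^{m-1}), with θ ∈ [0,1) the relative position in
the cell, and the square of 1/2 - θ integrates to Δt/12. -/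
theorem uInterp_sub_vInterp (hdt : 0 < dt) (hT : N * dt = T) :
    IntervalIntegrable (fun t => ‖uInterp dt N u t - vInterp dt N u t‖ ^ 2) volume 0 T ∧
      ∫ t in (0 : ℝ)..T, ‖uInterp dt N u t - vInterp dt N u t‖ ^ 2
        = dt / 12 * ∑ m ∈ Finset.Icc 1 N, ‖u m - u (m - 1)‖ ^ 2 := by
  set f : ℝ → ℝ := fun t => ‖uInterp dt N u t - vInterp dt N u t‖ ^ 2 with hf
  let a : ℕ → ℝ := fun k => k * dt
  have ha : ∀ k, a (k + 1) = a k + dt := fun k => by simp only [a]; push_cast; ring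
  let g : ℕ → ℝ → ℝ := fun k t => (1 / 2 - (t - a k) / dt) ^ 2 * ‖u (k + 1) - u k‖ ^ 2
  have hfg : ∀ k < N, Set.EqOn (g k) f (Set.Ioo (a k) (a (k + 1))) := by
    intro k hk t ht
    have h1 : (k : ℝ) * dt ≤ t := ht.1.le
    have h2 : t < (k + 1) * dt := by simpa [a] using ht.2
    simp only [hf, g]
    rw [uInterp_eq_stepFn, stepFn_eq hdt _ hk h1 h2, vInterp_eq hdt hk h1 h2.le, half,
      Nat.add_sub_cancel]
    have e : (1 / 2 : ℝ) • (u (k + 1) + u k) - (u k + ((t - k * dt) / dt) • (u (k + 1) - u k))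
        = (1 / 2 - (t - k * dt) / dt) • (u (k + 1) - u k) := by module
    rw [e, norm_smul, mul_pow, Real.norm_eq_abs, sq_abs]
  have hle : ∀ k, a k ≤ a (k + 1) := fun k => by rw [ha]; linarith
  have hgi : ∀ k, IntervalIntegrable (g k) volume (a k) (a (k + 1)) := fun k =>
    Continuous.intervalIntegrable (by fun_prop) _ _
  have hfi : ∀ k < N, IntervalIntegrable f volume (a k) (a (k + 1)) := fun k hk =>
    (hgi k).congr_uIoo (by rw [Set.uIoo_of_le (hle k)]; exact hfg k hk)
  have h0 : a 0 = 0 := by simp [a]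
  have hN : a N = T := hT
  rw [← h0, ← hN]
  refine ⟨IntervalIntegrable.trans_iterate hfi, ?_⟩
  rw [← intervalIntegral.sum_integral_adjacent_intervals hfi, sum_Icc_one, Finset.mul_sum]
  refine Finset.sum_congr rfl fun k hk => ?_
  rw [← intervalIntegral.integral_congr_Ioo_of_le (hle k) (hfg k (Finset.mem_range.1 hk)),
    Nat.add_sub_cancel]
  simp only [g]
  rw [intervalIntegral.integral_mul_const, ha, integral_half_sub_sq hdt]

end

end CrankNicolsonNSE

end

/-! ### The a priori bounds -/

open CrankNicolsonNSE in
theorem proposition4p3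
    (T ν : ℝ) (hT : 0 < T) (hν : 0 < ν)
    (H : Set ℝ) (D : ℝ → DiscretePair) (hD : Admissible H D)
    (κ : Convection) (u₀ : VecL2) (hu₀ : MemL2Div u₀) :
    ∃ c : ℝ, 0 < c ∧
      ∀ P : Set (ℕ × ℝ), (∀ d ∈ P, 1 ≤ d.1 ∧ d.2 ∈ H) → MeshCondition T ν u₀ P →
      ∀ (N : ℕ) (h : ℝ), (N, h) ∈ P →
      ∀ (u : ℕ → VecL2) (p : ℕ → L2), IsCNSolution (D h) κ ν (T / N) N u₀ u p →
        -- a)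
        (MemLp (vInterp (T / N) N u) ∞ (timeMeasure T) ∧
          eLpNorm (vInterp (T / N) N u) ∞ (timeMeasure T) ≤ ENNReal.ofReal c) ∧
        -- b)
        (MemLp (uInterp (T / N) N u) ∞ (timeMeasure T) ∧
          eLpNorm (uInterp (T / N) N u) ∞ (timeMeasure T) ≤ ENNReal.ofReal c ∧
          (∀ t ∈ Set.Icc 0 T, MemH1Vec (uInterp (T / N) N u t)) ∧
          MemLp (fun t => h1Norm (uInterp (T / N) N u t)) 2 (timeMeasure T) ∧
          eLpNorm (fun t => h1Norm (uInterp (T / N) N u t)) 2 (timeMeasure T)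
            ≤ ENNReal.ofReal c) ∧
        -- c)
        (MemLp (pInterp (T / N) N p) (4 / 3) (timeMeasure T) ∧
          eLpNorm (pInterp (T / N) N p) (4 / 3) (timeMeasure T) ≤ ENNReal.ofReal c) ∧
        -- d)
        ((∀ᵐ t ∂(timeMeasure T), DifferentiableAt ℝ (vInterp (T / N) N u) t) ∧
          AEStronglyMeasurable (deriv (vInterp (T / N) N u)) (timeMeasure T) ∧
          (∀ s ∈ Set.Icc 0 T, ∀ t ∈ Set.Icc 0 T,
            IntervalIntegrable (deriv (vInterp (T / N) N u)) volume s t ∧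
            vInterp (T / N) N u t - vInterp (T / N) N u s
              = ∫ τ in s..t, deriv (vInterp (T / N) N u) τ) ∧
          eLpNorm (fun t => hNegOneNorm (deriv (vInterp (T / N) N u) t)) (4 / 3) (timeMeasure T)
            ≤ ENNReal.ofReal c) ∧
        -- closeness of the two interpolants
        (IntervalIntegrable
            (fun t => ‖uInterp (T / N) N u t - vInterp (T / N) N u t‖ ^ 2) volume 0 T ∧
          ∫ t in (0 : ℝ)..T, ‖uInterp (T / N) N u t - vInterp (T / N) N u t‖ ^ 2
            ≤ (T / N) / 12 * ∑ m ∈ Finset.Icc 1 N, ‖u m - u (m - 1)‖ ^ 2) := by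
  obtain ⟨C, hC, hbound⟩ := hD.exists_pressure_bound hν κ u₀
  -- `A` bounds Δt ∑ ‖u^{m,1/2}‖²_{H¹}. `B` bounds the 4/3-power sums for pressure and time
  -- derivative, through (1 + y)² ≤ 2 + 2y².
  set A : ℝ := T * ‖u₀‖ ^ 2 + ‖u₀‖ ^ 2 / (2 * ν) with hA
  have hA0 : 0 ≤ A := by positivity
  set B : ℝ := C ^ (4 / 3 : ℝ) * (2 * T + 2 * A) with hB
  have hB0 : 0 ≤ B := by positivity
  set c₁ : ℝ := A ^ (1 / 2 : ℝ) with hc₁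
  set c₂ : ℝ := B ^ (1 / (4 / 3) : ℝ) with hc₂
  have hc₁0 : 0 ≤ c₁ := by positivity
  have hc₂0 : 0 ≤ c₂ := by positivity
  have hu0 := norm_nonneg u₀
  refine ⟨1 + ‖u₀‖ + c₁ + c₂, by positivity, fun P hP _ N h hNh u p S => ?_⟩
  obtain ⟨hN, hh⟩ := hP _ hNh
  simp only at hN hh
  have hNpos : (0 : ℝ) < N := by exact_mod_cast hN
  set dt : ℝ := T / N with hdt_def
  have hdt : 0 < dt := div_pos hT hNpos
  have hNT : N * dt = T := by rw [hdt_def]; field_simp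
  have l0 : ENNReal.ofReal ‖u₀‖ ≤ ENNReal.ofReal (1 + ‖u₀‖ + c₁ + c₂) :=
    ENNReal.ofReal_le_ofReal (by linarith)
  have l1 : ENNReal.ofReal c₁ ≤ ENNReal.ofReal (1 + ‖u₀‖ + c₁ + c₂) :=
    ENNReal.ofReal_le_ofReal (by linarith)
  have l2 : ENNReal.ofReal c₂ ≤ ENNReal.ofReal (1 + ‖u₀‖ + c₁ + c₂) :=
    ENNReal.ofReal_le_ofReal (by linarith)
  have e43 : (4 / 3 : ℝ≥0∞) = ENNReal.ofReal (4 / 3) := by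
    rw [ENNReal.ofReal_div_of_pos (by norm_num)]; norm_num
  have e2 : (2 : ℝ≥0∞) = ENNReal.ofReal 2 := by norm_num
  have hsum := S.sum_h1Norm_sq_le hν hdt
  rw [hNT] at hsum
  have hY0 : ∀ m, 0 ≤ C * (1 + h1Norm (half u m)) ^ (3 / 2 : ℝ) := fun m => by
    have := h1Norm_nonneg (half u m)
    positivity
  have hsum2 : ∑ m ∈ Finset.Icc 1 N,
      dt * (C * (1 + h1Norm (half u m)) ^ (3 / 2 : ℝ)) ^ (4 / 3 : ℝ) ≤ B := by
    calc ∑ m ∈ Finset.Icc 1 N, dt * (C * (1 + h1Norm (half u m)) ^ (3 / 2 : ℝ)) ^ (4 / 3 : ℝ)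
        ≤ ∑ m ∈ Finset.Icc 1 N,
          C ^ (4 / 3 : ℝ) * (2 * dt + 2 * (dt * h1Norm (half u m) ^ 2)) := by
          refine Finset.sum_le_sum fun m _ => ?_
          have hy := h1Norm_nonneg (half u m)
          rw [Real.mul_rpow hC.le (by positivity), ← Real.rpow_mul (by positivity),
            show (3 / 2 * (4 / 3) : ℝ) = (2 : ℕ) by norm_num, Real.rpow_natCast, mul_left_comm]
          have : dt * (1 + h1Norm (half u m)) ^ 2
              ≤ 2 * dt + 2 * (dt * h1Norm (half u m) ^ 2) := by
            nlinarith [mul_nonneg hdt.le (sq_nonneg (1 - h1Norm (half u m)))]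
          gcongr
      _ = C ^ (4 / 3 : ℝ) * (2 * (N * dt)
            + 2 * ∑ m ∈ Finset.Icc 1 N, dt * h1Norm (half u m) ^ 2) := by
          rw [← Finset.mul_sum, Finset.sum_add_distrib, Finset.sum_const,
            Nat.card_Icc, Nat.add_sub_cancel, nsmul_eq_mul]
          congr 1
          rw [Finset.mul_sum]
          ring
      _ ≤ B := by
          rw [hNT, hB]
          gcongr
  have hvb : ∀ᵐ t ∂(timeMeasure T), ‖vInterp dt N u t‖ ≤ ‖u₀‖ := by
    rw [timeMeasure, ae_restrict_iff' measurableSet_Icc]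
    exact Eventually.of_forall fun t ht =>
      norm_vInterp_le hdt hN hNT (fun m hm => S.norm_le hν hdt hm) ht
  have hub : ∀ᵐ t ∂(timeMeasure T), ‖uInterp dt N u t‖ ≤ ‖u₀‖ := by
    rw [timeMeasure, ae_restrict_iff' measurableSet_Icc]
    refine Eventually.of_forall fun t ht => ?_
    obtain ⟨m, _, h2, h3⟩ := exists_stepFn_eq hdt hN (half u) ht.1
    rw [uInterp_eq_stepFn, h3]
    exact S.norm_half_le hν hdt h2
  have hvm : AEStronglyMeasurable (vInterp dt N u) (timeMeasure T) :=
    (continuousOn_vInterp hdt hNT).aestronglyMeasurable measurableSet_Icc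
  have hum : AEStronglyMeasurable (uInterp dt N u) (timeMeasure T) :=
    (stronglyMeasurable_stepFn dt N (half u)).aestronglyMeasurable
  have hyfun : (fun t => h1Norm (uInterp dt N u t))
      = stepFn dt N (fun m => h1Norm (half u m)) :=
    funext fun t => comp_stepFn h1Norm dt N (half u) t
  have hyb : eLpNorm (fun t => h1Norm (uInterp dt N u t)) 2 (timeMeasure T)
      ≤ ENNReal.ofReal c₁ := by
    rw [hyfun, e2]
    refine eLpNorm_stepFn_le hdt hNT (a := fun m => h1Norm (half u m)) two_pos
      (fun m => h1Norm_nonneg _) hA0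
      (fun m _ _ => by rw [Real.enorm_of_nonneg (h1Norm_nonneg _)]) ?_
    simpa using hsum
  have hpb : eLpNorm (pInterp dt N p) (4 / 3) (timeMeasure T) ≤ ENNReal.ofReal c₂ := by
    rw [pInterp_eq_stepFn, e43]
    refine eLpNorm_stepFn_le hdt hNT (by norm_num) hY0 hB0 (fun m h1 h2 => ?_) hsum2
    rw [← ofReal_norm]
    exact ENNReal.ofReal_le_ofReal (hbound h hh dt N u p hdt S m h1 h2).1
  have hdb : eLpNorm (fun t => hNegOneNorm (deriv (vInterp dt N u) t)) (4 / 3) (timeMeasure T)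
      ≤ ENNReal.ofReal c₂ := by
    -- The two sides may differ at grid points, where the interpolant can have a kink; these form a
    -- null set.
    have hae : (fun t => hNegOneNorm (deriv (vInterp dt N u) t)) =ᵐ[timeMeasure T]
        stepFn dt N (fun m => hNegOneNorm (dt⁻¹ • (u m - u (m - 1)))) := by
      filter_upwards [ae_hasDerivAt_vInterp (u := u) hdt hNT] with t ht
      rw [ht.deriv]
      exact comp_stepFn hNegOneNorm dt N _ t
    rw [eLpNorm_congr_ae hae, e43]
    refine eLpNorm_stepFn_le hdt hNT (by norm_num) hY0 hB0 (fun m h1 h2 => ?_) hsum2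
    rw [enorm_eq_self]
    exact (hbound h hh dt N u p hdt S m h1 h2).2
  have huv := uInterp_sub_vInterp (u := u) hdt hNT
  refine ⟨⟨memLp_top_of_bound hvm _ hvb, ?_⟩, ⟨memLp_top_of_bound hum _ hub, ?_, ?_, ⟨?_, ?_⟩, ?_⟩,
    ⟨⟨?_, ?_⟩, ?_⟩, ⟨?_, ?_, ?_, ?_⟩, huv.1, huv.2.le⟩
  · rw [eLpNorm_exponent_top]
    exact (eLpNormEssSup_le_of_ae_bound hvb).trans l0
  · rw [eLpNorm_exponent_top]
    exact (eLpNormEssSup_le_of_ae_bound hub).trans l0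
  · intro t ht
    obtain ⟨m, _, h2, h3⟩ := exists_stepFn_eq hdt hN (half u) ht.1
    rw [uInterp_eq_stepFn, h3]
    exact ((D h).memX _ (S.memV_half h2).1).1
  · rw [hyfun]
    exact (stronglyMeasurable_stepFn dt N _).aestronglyMeasurable
  · exact hyb.trans_lt ENNReal.ofReal_lt_top
  · exact hyb.trans l1
  · exact (stronglyMeasurable_stepFn dt N p).aestronglyMeasurable
  · exact hpb.trans_lt ENNReal.ofReal_lt_top
  · exact hpb.trans l2
  · exact (ae_hasDerivAt_vInterp hdt hNT).mono fun t ht => ht.differentiableAt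
  · exact (integrable_deriv_vInterp hdt hN hNT).aestronglyMeasurable
  · exact fun s hs t ht => vInterp_sub_eq_integral hdt hN hNT hs ht
  · exact hdb.trans l2
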